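/- For positive integers $q$ and $h$ define $$V_3(q;h)=\sum_{\substack{d_1,d_2,d_3\\ 1\le d_i\le h}}\ \sum_{\substack{q_1,q_2,q_3\\ 1<q_i\mid q}}\left(\prod_{i=1}^3\frac{\mu(q_i)}{\phi(q_i)}\right)\sum_{\substack{a_1,a_2,a_3\\ 1\le a_i\le q_i,\ (a_i,q_i)=1\\ \sum_i a_i/q_i\in\mathbb Z}} e\left(\sum_{i=1}^3\frac{a_id_i}{q_i}\right),\qquad e(x)=e^{2\pi i x},$$ where the $d_i,q_i,a_i$ are integers, $\mu$ is the Möbius function and $\phi$ is Euler's totient function. There is an absolute constant $C>0$ such that for every integer $h\ge 2$, if $q=\prod_{p\le h^4}p$ is the product of the primes up to $h^4$, then $$|V_3(q;h)|\le C\,h(\log h)^4(\log\log h)^2 .$$ -/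

import Mathlib

/-- The additive character `e(x) = exp(2πix)`. -/
noncomputable def addExp (x : ℝ) : ℂ := Complex.exp (2 * Real.pi * Complex.I * x)

open Classical in
/-- The tuples `a = (a₁, …, a_k)` with `1 ≤ aᵢ ≤ rᵢ`, `(aᵢ, rᵢ) = 1` and `∑ aᵢ / rᵢ ∈ ℤ`. -/
noncomputable def numerators {k : ℕ} (r : Fin k → ℕ) : Finset (Fin k → ℕ) :=
  (Fintype.piFinset fun i => (Finset.Icc 1 (r i)).filter fun a => Nat.Coprime a (r i)).filter
    fun a => ∃ n : ℤ, ∑ i, (a i : ℚ) / (r i : ℚ) = n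

/-- The singular series sum `V_k(q; h)`: the sum over `d₁, …, d_k` with `1 ≤ dᵢ ≤ h` and over
divisors `q₁, …, q_k > 1` of `q` of `∏ μ(qᵢ) / φ(qᵢ)` times the sum of `e(∑ aᵢ dᵢ / qᵢ)` over
the reduced numerators `aᵢ` modulo `qᵢ` with `∑ aᵢ / qᵢ ∈ ℤ`. -/
noncomputable def singularSeriesSum (k q h : ℕ) : ℂ :=
  ∑ d ∈ Fintype.piFinset (fun _ : Fin k => Finset.Icc 1 h),
    ∑ r ∈ Fintype.piFinset (fun _ : Fin k => q.divisors.filter fun m => 1 < m),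
      (∏ i, (ArithmeticFunction.moebius (r i) : ℂ) / (Nat.totient (r i) : ℂ)) *
        ∑ a ∈ numerators r, addExp (∑ i, (a i : ℝ) * (d i : ℝ) / (r i : ℝ))

/-!
Write `E(t) = ∑_{d ≤ h} e(dt)`, so that `|E(t)| ≪ h / (1 + h‖t‖)` with `‖t‖` the distance to the
nearest integer. Summing over the `dᵢ` first, the singular series sum becomes the sum over
denominators `q₁, q₂, q₃ > 1` and reduced fractions `αᵢ = aᵢ / qᵢ` with integral sum of
`∏ μ(qᵢ) / φ(qᵢ) · E(αᵢ)`, and absolute values are inserted. The condition `∑ αᵢ ∈ ℤ` forces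
`(q₁, q₂, q₃) = (g y z, g x z, g x y)` with `g, x, y, z` pairwise coprime
(`exists_param_of_mem_fracTriples`). If the fractions were equidistributed, each `(g, x, y, z)`
would contribute about `h / φ(g x y z)`, and the sum over `g, x, y, z ∣ q` would be
`≪ h (log h) ^ 4` by Mertens.

Since `‖α₁‖ ≤ ‖α₂‖ + ‖α₃‖` and so on, the product of the three factors `(1 + h‖αᵢ‖)⁻¹` is at most
twice the sum over `j = 2, 3` of `((1 + h‖α₁‖) (1 + h‖αⱼ‖)) ^ (-3/2)` (`prod_le_decay`). So it
suffices to sum the function `(1 + h‖t‖) ^ (-3/2)` over `α₁`, and then over `α₂` or `α₃` for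
fixed `α₁`. Over points that are separated by `δ`, and either stay `δ` away from the integers
or have `δ ≤ 1 / h`, that sum is `≪ 1 / (h δ)` (`sum_decay_circDist_le`). The points `α₁` are
separated by `1 / (g y z)`. For fixed `α₁`, two values of `α₂`, with parameters `x, x'`, differ by
at least `1 / (g [x, x'])` (`inv_le_abs_sub_of_fracTriples`). This gives the expected bound in two
situations, both covered by `sum_tripleSum_le`:

* for a single `x` with `g x ≥ h`, as the points `α₂` are then separated by `1 / (g x) ≤ 1 / h`;
* on average over `x` in a dyadic block, if `x` is the largest of `x, y, z`: the points `α₂` are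
  then separated by `≫ 1 / (g x²)`, which is also a lower bound for their distance to `ℤ`.

The first situation, up to permuting `x, y, z`, contributes `≪ h (log h) ^ 4`. In the second one
`x ≤ h`, the factor `(x / φ(x))²` is bounded pointwise by `(log log h)²`, there are `≪ log h` dyadic
blocks, and the sums over `g, y, z` give `(log h) ^ 3`.
-/

/-! ### Geometric sums and the distance to the nearest integer -/

/-- The distance from `t` to the nearest integer, for `t` in the unit interval. -/
noncomputable def circDist (t : ℝ) : ℝ := min t (1 - t)

lemma circDist_pos {t : ℝ} (h0 : 0 < t) (h1 : t < 1) : 0 < circDist t :=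
  lt_min h0 (by linarith)

lemma two_mul_circDist_le_sin {t : ℝ} (h0 : 0 < t) (h1 : t < 1) :
    2 * circDist t ≤ Real.sin (Real.pi * t) := by
  have hπ := Real.pi_pos
  rcases le_total t (1 / 2) with h | h
  · have := Real.mul_le_sin (x := Real.pi * t) (by positivity) (by nlinarith)
    have e : 2 / Real.pi * (Real.pi * t) = 2 * t := by field_simp
    rw [e] at this
    exact le_trans (by gcongr; exact min_le_left _ _) this
  · have := Real.mul_le_sin (x := Real.pi * (1 - t)) (by nlinarith) (by nlinarith)
    have e : 2 / Real.pi * (Real.pi * (1 - t)) = 2 * (1 - t) := by field_simp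
    have e' : Real.pi * (1 - t) = Real.pi - Real.pi * t := by ring
    rw [e, e', Real.sin_pi_sub] at this
    exact le_trans (by gcongr; exact min_le_right _ _) this

lemma norm_addExp (t : ℝ) : ‖addExp t‖ = 1 := by
  have : addExp t = Complex.exp ((2 * Real.pi * t : ℝ) * Complex.I) := by
    unfold addExp; congr 1; push_cast; ring
  rw [this, Complex.norm_exp_ofReal_mul_I]

lemma addExp_sum {ι : Type*} (s : Finset ι) (f : ι → ℝ) :
    addExp (∑ i ∈ s, f i) = ∏ i ∈ s, addExp (f i) := by
  unfold addExp
  rw [← Complex.exp_sum]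
  congr 1
  push_cast
  rw [Finset.mul_sum]

lemma addExp_mul_natCast (t : ℝ) (d : ℕ) : addExp (t * d) = addExp t ^ d := by
  unfold addExp
  rw [← Complex.exp_nat_mul]
  congr 1
  push_cast
  ring

lemma norm_addExp_sub_one {t : ℝ} (h0 : 0 < t) (h1 : t < 1) :
    ‖addExp t - 1‖ = 2 * Real.sin (Real.pi * t) := by
  have e : addExp t = Complex.exp (Complex.I * (2 * Real.pi * t : ℝ)) := by
    unfold addExp; congr 1; push_cast; ring
  have hs := two_mul_circDist_le_sin h0 h1
  have hc := circDist_pos h0 h1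
  rw [e, Complex.norm_exp_I_mul_ofReal_sub_one, Real.norm_eq_abs]
  have : 2 * Real.pi * t / 2 = Real.pi * t := by ring
  rw [this, abs_of_nonneg (by linarith)]

/-- The geometric sum bound `|∑_{d ≤ h} e(dt)| ≤ min(h, 1 / (2‖t‖))`, in a smoothed form. -/
lemma norm_sum_addExp_le {t : ℝ} (h0 : 0 < t) (h1 : t < 1) (h : ℕ) :
    ‖∑ d ∈ Finset.Icc 1 h, addExp (t * d)‖ ≤ 2 * h / (1 + h * circDist t) := by
  have hc := circDist_pos h0 h1
  have hs := two_mul_circDist_le_sin h0 h1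
  have hn := norm_addExp_sub_one h0 h1
  have hh : (0 : ℝ) ≤ h := h.cast_nonneg
  have triv : ‖∑ d ∈ Finset.Icc 1 h, addExp (t * d)‖ ≤ h := by
    refine (norm_sum_le _ _).trans ?_
    simp [norm_addExp]
  have geom : ‖∑ d ∈ Finset.Icc 1 h, addExp (t * d)‖ * (2 * circDist t) ≤ 1 := by
    have e : (∑ d ∈ Finset.Icc 1 h, addExp (t * d)) * (addExp t - 1)
        = addExp t * (addExp t ^ h - 1) := by
      simp_rw [addExp_mul_natCast]
      rw [← geom_sum_mul, ← mul_assoc, Finset.mul_sum]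
      congr 1
      refine (Finset.sum_bij (fun d _ => d + 1) ?_ ?_ ?_ ?_).symm
      · intro d hd
        simp only [Finset.mem_range, Finset.mem_Icc] at *
        omega
      · intro d _ d' _ hdd
        omega
      · intro d hd
        simp only [Finset.mem_Icc] at hd
        exact ⟨d - 1, by simp only [Finset.mem_range]; omega, by omega⟩
      · intro d _
        rw [pow_succ']
    have h2 : ‖addExp t * (addExp t ^ h - 1)‖ ≤ 2 := by
      rw [norm_mul, norm_addExp, one_mul]
      refine (norm_sub_le _ _).trans ?_
      rw [norm_pow, norm_addExp, norm_one]
      norm_num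
    rw [← e, norm_mul, hn] at h2
    have := norm_nonneg (∑ d ∈ Finset.Icc 1 h, addExp (t * d))
    nlinarith
  rw [le_div_iff₀ (by positivity)]
  nlinarith

/-- If `α + β + γ` is an integer, each of the three distances to the nearest integer is at most
the sum of the other two. -/
lemma circDist_triangle {a b c : ℝ} (ha : 0 < a) (ha1 : a < 1) (hb : 0 < b) (hb1 : b < 1)
    (hc : 0 < c) (hc1 : c < 1) (hn : ∃ n : ℤ, a + b + c = n) :
    circDist a ≤ circDist b + circDist c := by
  obtain ⟨n, hn⟩ := hn
  have h1 : (0 : ℝ) < n := by linarith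
  have h2 : (n : ℝ) < 3 := by linarith
  have h1' : 0 < n := by exact_mod_cast h1
  have h2' : n < 3 := by exact_mod_cast h2
  unfold circDist
  have : n = 1 ∨ n = 2 := by omega
  rcases this with rfl | rfl <;> push_cast at hn <;>
  rcases min_choice b (1 - b) with e | e <;> rcases min_choice c (1 - c) with e' | e' <;>
  rw [e, e'] <;> first
    | exact (min_le_left _ _).trans (by linarith)
    | exact (min_le_right _ _).trans (by linarith)

/-! ### Sums over separated points -/

/-- The decay profile `(1 + h t)^(-3/2)`. Its exponent exceeds `1`, so that it is summable over
separated points; two factors of it dominate the product of three factors `(1 + h t)⁻¹`. -/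
noncomputable def decay (h t : ℝ) : ℝ := 1 / √(1 + h * t) ^ 3

lemma decay_nonneg (h t : ℝ) : 0 ≤ decay h t := by unfold decay; positivity

lemma decay_anti {h s t : ℝ} (hh : 0 ≤ h) (hs : 0 ≤ s) (hst : s ≤ t) :
    decay h t ≤ decay h s := by
  unfold decay
  have : 0 < √(1 + h * s) := Real.sqrt_pos.2 (by positivity)
  gcongr

lemma decay_le_one {h t : ℝ} (hh : 0 ≤ h) (ht : 0 ≤ t) : decay h t ≤ 1 := by
  have := decay_anti hh le_rfl ht
  simpa [decay] using this

/-- `1 / (abc) ≤ 2 (ab)^(-3/2)` when `b ≤ c` and `a ≤ b + c`. -/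
lemma one_div_mul_mul_le {a b c : ℝ} (ha : 0 < a) (hb : 0 < b) (hbc : b ≤ c)
    (habc : a ≤ b + c) : 1 / (a * b * c) ≤ 2 * (1 / √a ^ 3 * (1 / √b ^ 3)) := by
  have hc : 0 < c := hb.trans_le hbc
  have h1 : √a * √b ≤ 2 * c := by
    rw [← Real.sqrt_mul ha.le]
    exact Real.sqrt_le_iff.2 ⟨by positivity, by nlinarith⟩
  have e : 2 * (1 / √a ^ 3 * (1 / √b ^ 3)) = 2 / ((√a * √b) * (a * b)) := by
    have hsa : 0 < √a := Real.sqrt_pos.2 ha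
    have hsb : 0 < √b := Real.sqrt_pos.2 hb
    have e1 : √a ^ 3 = √a * a := by rw [pow_succ', Real.sq_sqrt ha.le]
    have e2 : √b ^ 3 = √b * b := by rw [pow_succ', Real.sq_sqrt hb.le]
    rw [e1, e2]; field_simp
  rw [e, div_le_div_iff₀ (by positivity) (by positivity)]
  have : √a * √b * (a * b) ≤ 2 * c * (a * b) := by gcongr
  linarith

/-- Three fractions with integral sum: the product of the three factors is controlled by two
factors with the larger exponent `3/2`, the first point being always one of the two. -/
lemma prod_le_decay {h a b c : ℝ} (hh : 0 ≤ h) (ha : 0 < a) (ha1 : a < 1) (hb : 0 < b)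
    (hb1 : b < 1) (hc : 0 < c) (hc1 : c < 1) (hn : ∃ n : ℤ, a + b + c = n) :
    1 / ((1 + h * circDist a) * (1 + h * circDist b) * (1 + h * circDist c)) ≤
      2 * (decay h (circDist a) * decay h (circDist b) +
        decay h (circDist a) * decay h (circDist c)) := by
  have t := circDist_triangle ha ha1 hb hb1 hc hc1 hn
  have pa := circDist_pos ha ha1
  have pb := circDist_pos hb hb1
  have pc := circDist_pos hc hc1
  have dab := mul_nonneg (decay_nonneg h (circDist a)) (decay_nonneg h (circDist b))
  have dac := mul_nonneg (decay_nonneg h (circDist a)) (decay_nonneg h (circDist c))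
  have t' : 1 + h * circDist a ≤ (1 + h * circDist b) + (1 + h * circDist c) := by
    nlinarith
  rcases le_total (circDist b) (circDist c) with hbc | hbc
  · have := one_div_mul_mul_le (a := 1 + h * circDist a) (b := 1 + h * circDist b)
      (c := 1 + h * circDist c) (by positivity) (by positivity) (by gcongr) t'
    refine this.trans ?_
    unfold decay at *
    linarith
  · have := one_div_mul_mul_le (a := 1 + h * circDist a) (b := 1 + h * circDist c)
      (c := 1 + h * circDist b) (by positivity) (by positivity) (by gcongr) (by linarith)
    rw [mul_right_comm] at this
    refine this.trans ?_
    unfold decay at *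
    linarith

/-- A telescoping bound for `∑_{k ≥ 1} (1 + ck)^(-3/2)`. -/
lemma decay_succ_le {c : ℝ} (hc : 0 < c) (k : ℕ) :
    decay c (k + 1 : ℕ) ≤ 2 / c * (1 / √(1 + c * k) - 1 / √(1 + c * (k + 1 : ℕ))) := by
  unfold decay
  have pa : (0 : ℝ) < 1 + c * k := by positivity
  have pb : (0 : ℝ) < 1 + c * (k + 1 : ℕ) := by positivity
  have ha : 0 < √(1 + c * k) := Real.sqrt_pos.2 pa
  have hb : 0 < √(1 + c * (k + 1 : ℕ)) := Real.sqrt_pos.2 pb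
  have hab : √(1 + c * k) ≤ √(1 + c * (k + 1 : ℕ)) := by gcongr; simp
  have hd : c = √(1 + c * (k + 1 : ℕ)) ^ 2 - √(1 + c * k) ^ 2 := by
    rw [Real.sq_sqrt pa.le, Real.sq_sqrt pb.le]; push_cast; ring
  generalize √(1 + c * k) = a at *
  generalize √(1 + c * (k + 1 : ℕ)) = b at *
  have hne : 0 < b - a := by nlinarith
  have e : 2 / c * (1 / a - 1 / b) = 2 / ((a + b) * a * b) := by
    have hc' : c = (b - a) * (a + b) := by rw [hd]; ring
    rw [hc']; field_simp
  rw [e, div_le_div_iff₀ (by positivity) (by positivity)]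
  nlinarith [mul_pos ha hb, mul_pos hb hb, mul_nonneg ha.le hne.le, mul_nonneg hb.le hne.le,
    mul_nonneg (mul_pos hb hb).le hne.le, mul_nonneg (mul_pos ha hb).le hne.le]

lemma sum_range_decay_succ_le {c : ℝ} (hc : 0 < c) (n : ℕ) :
    ∑ k ∈ Finset.range n, decay c (k + 1 : ℕ) ≤ 2 / c := by
  have h1 : ∑ k ∈ Finset.range n, decay c (k + 1 : ℕ) ≤
      2 / c * (1 / √(1 + c * (0 : ℕ)) - 1 / √(1 + c * n)) := by
    rw [← Finset.sum_range_sub' (fun k : ℕ => 1 / √(1 + c * k)), Finset.mul_sum]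
    exact Finset.sum_le_sum fun k _ => decay_succ_le hc k
  refine h1.trans ?_
  have : 0 ≤ 1 / √(1 + c * n) := by positivity
  have h2 : 1 / √(1 + c * (0 : ℕ)) - 1 / √(1 + c * n) ≤ 1 := by simp
  calc _ ≤ 2 / c * 1 := by gcongr
    _ = _ := mul_one _

/-- One-sided sum over points separated by `δ`: either all points are at least `δ`, or
`δ ≤ 1 / h`, which absorbs the point in `[0, δ)`. -/
lemma sum_decay_le {ι : Type*} (s : Finset ι) (θ : ι → ℝ) {h δ : ℝ} (hh : 0 < h) (hδ : 0 < δ)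
    (h0 : ∀ i ∈ s, 0 ≤ θ i) (hsep : ∀ i ∈ s, ∀ j ∈ s, i ≠ j → δ ≤ |θ i - θ j|)
    (hmin : h * δ ≤ 1 ∨ ∀ i ∈ s, δ ≤ θ i) :
    ∑ i ∈ s, decay h (θ i) ≤ 3 / (h * δ) := by
  classical
  -- each bin `[k δ, (k + 1) δ)` holds at most one point
  set b : ι → ℕ := fun i => ⌊θ i / δ⌋₊ with hb
  have hb1 : ∀ i ∈ s, (b i : ℝ) * δ ≤ θ i := fun i hi => by
    have := Nat.floor_le (div_nonneg (h0 i hi) hδ.le)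
    rwa [le_div_iff₀ hδ] at this
  have hb2 : ∀ i, θ i < (b i + 1) * δ := fun i => by
    have := Nat.lt_floor_add_one (θ i / δ)
    rwa [div_lt_iff₀ hδ] at this
  have hinj : Set.InjOn b s := by
    intro i hi j hj hij
    by_contra hne
    have h1 := hsep i hi j hj hne
    have a1 := hb1 i hi; have a2 := hb1 j hj; have a3 := hb2 i; have a4 := hb2 j
    rw [hij] at a1 a3
    have : |θ i - θ j| < δ := by rw [abs_lt]; constructor <;> linarith
    linarith
  have hc : 0 < h * δ := by positivity
  have step : ∑ i ∈ s, decay h (θ i) ≤ ∑ k ∈ s.image b, decay (h * δ) k := by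
    rw [Finset.sum_image hinj]
    refine Finset.sum_le_sum fun i hi => ?_
    have := decay_anti hh.le (by positivity) (hb1 i hi)
    refine this.trans (le_of_eq ?_)
    unfold decay
    congr 4
    ring
  obtain ⟨n, hn⟩ : ∃ n : ℕ, s.image b ⊆ Finset.range (n + 1) :=
    ⟨(s.image b).sup id, fun k hk => Finset.mem_range.2
      (Nat.lt_succ_of_le (Finset.le_sup (f := id) hk))⟩
  have tail := sum_range_decay_succ_le hc n
  have hle : (2 : ℝ) / (h * δ) ≤ 3 / (h * δ) := by gcongr; norm_num
  rcases hmin with hmin | hmin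
  · refine step.trans ((Finset.sum_le_sum_of_subset_of_nonneg hn
      fun _ _ _ => decay_nonneg _ _).trans ?_)
    rw [Finset.sum_range_succ']
    have h1 : decay (h * δ) (0 : ℕ) ≤ 1 := decay_le_one hc.le (by simp)
    have h2 : 1 ≤ 1 / (h * δ) := by rw [le_div_iff₀ hc]; linarith
    have h3 : 3 / (h * δ) = 2 / (h * δ) + 1 / (h * δ) := by ring
    rw [h3]
    exact add_le_add tail (h1.trans h2)
  · have h0' : 0 ∉ s.image b := by
      intro hk
      obtain ⟨i, hi, hi0⟩ := Finset.mem_image.1 hk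
      have := hb2 i
      rw [hi0] at this
      have := hmin i hi
      simp at *
      linarith
    have : ∑ k ∈ s.image b, decay (h * δ) k ≤
        ∑ k ∈ (Finset.range (n + 1)).erase 0, decay (h * δ) k :=
      Finset.sum_le_sum_of_subset_of_nonneg
        (fun k hk => Finset.mem_erase.2 ⟨fun e => h0' (e ▸ hk), hn hk⟩)
        fun _ _ _ => decay_nonneg _ _
    refine (step.trans this).trans ?_
    have e : ∑ k ∈ (Finset.range (n + 1)).erase 0, decay (h * δ) k =
        ∑ k ∈ Finset.range n, decay (h * δ) (k + 1 : ℕ) := by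
      have := Finset.sum_range_succ' (fun k : ℕ => decay (h * δ) k) n
      rw [← Finset.add_sum_erase _ _ (Finset.mem_range.2 n.succ_pos)] at this
      linarith
    rw [e]
    exact tail.trans hle

/-- Two-sided version of `sum_decay_le` for points of the unit interval. -/
lemma sum_decay_circDist_le {ι : Type*} (s : Finset ι) (θ : ι → ℝ) {h δ : ℝ} (hh : 0 < h)
    (hδ : 0 < δ) (h0 : ∀ i ∈ s, 0 ≤ θ i) (h1 : ∀ i ∈ s, θ i ≤ 1)
    (hsep : ∀ i ∈ s, ∀ j ∈ s, i ≠ j → δ ≤ |θ i - θ j|)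
    (hmin : h * δ ≤ 1 ∨ ∀ i ∈ s, δ ≤ θ i ∧ δ ≤ 1 - θ i) :
    ∑ i ∈ s, decay h (circDist (θ i)) ≤ 6 / (h * δ) := by
  have a1 := sum_decay_le s θ hh hδ h0 hsep (hmin.imp_right fun H i hi => (H i hi).1)
  have a2 := sum_decay_le s (fun i => 1 - θ i) hh hδ (fun i hi => by linarith [h1 i hi])
    (fun i hi j hj hij => by
      have := hsep i hi j hj hij
      rw [abs_sub_comm] at this
      simpa using this) (hmin.imp_right fun H i hi => (H i hi).2)
  have : ∑ i ∈ s, decay h (circDist (θ i)) ≤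
      ∑ i ∈ s, (decay h (θ i) + decay h (1 - θ i)) := by
    refine Finset.sum_le_sum fun i _ => ?_
    have := decay_nonneg h (θ i)
    have := decay_nonneg h (1 - θ i)
    unfold circDist
    rcases min_choice (θ i) (1 - θ i) with e | e <;> rw [e] <;> linarith
  rw [Finset.sum_add_distrib] at this
  have e : 6 / (h * δ) = 3 / (h * δ) + 3 / (h * δ) := by ring
  linarith

/-! ### Mertens' upper bound for sums over primes -/

lemma sum_log_primeFactors_le {n : ℕ} (hn : 0 < n) :
    ∑ p ∈ n.primeFactors, Real.log p ≤ Real.log n := by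
  rw [← Real.log_prod (fun p hp => by
    have := (Nat.prime_of_mem_primeFactors hp).pos
    positivity)]
  have h1 : ∏ p ∈ n.primeFactors, p ≤ n := Nat.le_of_dvd hn (Nat.prod_primeFactors_dvd n)
  have h2 : 0 < ∏ p ∈ n.primeFactors, p :=
    Finset.prod_pos fun p hp => (Nat.prime_of_mem_primeFactors hp).pos
  rw [← Nat.cast_prod]
  exact Real.log_le_log (by exact_mod_cast h2) (by exact_mod_cast h1)

/-- Mertens' first bound, obtained by comparing `log N!` with the contribution of the primes. -/
lemma sum_log_div_prime_le {N : ℕ} (hN : 0 < N) :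
    ∑ p ∈ Nat.primesLE N, Real.log p / p ≤ Real.log N + Real.log 4 := by
  have hN' : (0 : ℝ) < N := by exact_mod_cast hN
  have up : ∑ n ∈ Finset.Ioc 0 N, ∑ p ∈ n.primeFactors, Real.log p ≤ N * Real.log N := by
    calc _ ≤ ∑ n ∈ Finset.Ioc 0 N, Real.log N := by
          refine Finset.sum_le_sum fun n hn => ?_
          rw [Finset.mem_Ioc] at hn
          refine (sum_log_primeFactors_le hn.1).trans (Real.log_le_log ?_ ?_)
          · exact_mod_cast hn.1
          · exact_mod_cast hn.2
      _ = _ := by simp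
  have swap : ∑ n ∈ Finset.Ioc 0 N, ∑ p ∈ n.primeFactors, Real.log p =
      ∑ p ∈ Nat.primesLE N, ((N / p : ℕ) : ℝ) * Real.log p := by
    have e : ∀ p ∈ Nat.primesLE N, ((N / p : ℕ) : ℝ) * Real.log p =
        ∑ n ∈ (Finset.Ioc 0 N).filter (p ∣ ·), Real.log p := fun p _ => by
      rw [Finset.sum_const, Nat.Ioc_filter_dvd_card_eq_div, nsmul_eq_mul]
    rw [Finset.sum_congr rfl e]
    refine Finset.sum_comm' fun n p => ?_
    simp only [Finset.mem_Ioc, Nat.mem_primeFactors, Finset.mem_filter, Nat.mem_primesLE]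
    constructor
    · rintro ⟨⟨h1, h2⟩, h3, h4, h5⟩
      exact ⟨⟨⟨h1, h2⟩, h4⟩, (Nat.le_of_dvd h1 h4).trans h2, h3⟩
    · rintro ⟨⟨⟨h1, h2⟩, h4⟩, h5, h6⟩
      exact ⟨⟨h1, h2⟩, h6, h4, by omega⟩
  have theta : ∑ p ∈ Nat.primesLE N, Real.log p ≤ Real.log 4 * N := by
    rw [← Chebyshev.theta_eq_sum_primesLE_log]
    exact Chebyshev.theta_le_log4_mul_x hN'.le
  have low : ∑ p ∈ Nat.primesLE N, (N * (Real.log p / p) - Real.log p) ≤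
      ∑ p ∈ Nat.primesLE N, ((N / p : ℕ) : ℝ) * Real.log p := by
    refine Finset.sum_le_sum fun p hp => ?_
    have hp0 := (Nat.prime_of_mem_primesLE hp).pos
    have hp0' : (0 : ℝ) < p := by exact_mod_cast hp0
    have h1 : (N : ℝ) / p - 1 ≤ ((N / p : ℕ) : ℝ) := by
      have : N < p * (N / p + 1) := Nat.lt_mul_div_succ N hp0
      have : (N : ℝ) < p * ((N / p : ℕ) + 1) := by exact_mod_cast this
      rw [sub_le_iff_le_add, div_le_iff₀ hp0']
      linarith
    have h2 : 0 ≤ Real.log p := Real.log_natCast_nonneg p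
    calc N * (Real.log p / p) - Real.log p = (N / p - 1) * Real.log p := by ring
      _ ≤ _ := by gcongr
  rw [Finset.sum_sub_distrib, ← Finset.mul_sum] at low
  rw [swap] at up
  have : N * ∑ p ∈ Nat.primesLE N, Real.log p / p ≤ N * (Real.log N + Real.log 4) := by
    linarith
  exact le_of_mul_le_mul_left this hN'

lemma sum_primesLE_succ (f : ℕ → ℝ) (N : ℕ) :
    ∑ p ∈ Nat.primesLE (N + 1), f p =
      ∑ p ∈ Nat.primesLE N, f p + if (N + 1).Prime then f (N + 1) else 0 := by
  simp only [Nat.primesLE_eq_filter_range, Finset.sum_filter]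
  rw [Finset.sum_range_succ]

/-- Mertens' second bound, by partial summation from `sum_log_div_prime_le`. The induction
carries the exact boundary term of the summation by parts. -/
lemma exists_sum_one_div_prime_le :
    ∃ K : ℝ, ∀ N : ℕ, 2 ≤ N →
      ∑ p ∈ Nat.primesLE N, (1 : ℝ) / p ≤ Real.log (Real.log N) + K := by
  set c := Real.log 4 with hc
  set K := c / Real.log 2 - Real.log (Real.log 2) with hK
  have key : ∀ N : ℕ, 2 ≤ N → ∑ p ∈ Nat.primesLE N, (1 : ℝ) / p -
      (∑ p ∈ Nat.primesLE N, Real.log p / p) / Real.log N ≤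
        Real.log (Real.log N) - c / Real.log N + K := by
    intro N hN
    induction N, hN using Nat.le_induction with
    | base =>
      have e : Nat.primesLE 2 = {2} := by decide
      have : Real.log 2 ≠ 0 := (Real.log_pos (by norm_num)).ne'
      rw [e]
      simp only [Finset.sum_singleton, hK]
      push_cast
      have : (1 : ℝ) / 2 - Real.log 2 / 2 / Real.log 2 = 0 := by field_simp; ring
      rw [this]
      linarith
    | succ N hN ih =>
      have hN0 : (0 : ℝ) < N := by positivity
      have l1 : 0 < Real.log N := Real.log_pos (by exact_mod_cast hN)
      have l12 : Real.log N ≤ Real.log (N + 1 : ℕ) := by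
        apply Real.log_le_log hN0; push_cast; linarith
      have l2 : 0 < Real.log (N + 1 : ℕ) := by linarith
      have A := sum_log_div_prime_le (N := N) (by omega)
      rw [sum_primesLE_succ, sum_primesLE_succ]
      -- the new prime contributes equally to both sums once the second is divided by the logarithm
      have cancel : (if (N + 1).Prime then (1 : ℝ) / (N + 1 : ℕ) else 0) -
          (if (N + 1).Prime then Real.log (N + 1 : ℕ) / (N + 1 : ℕ) else 0) /
            Real.log (N + 1 : ℕ) = 0 := by
        split_ifs
        · field_simp; ring
        · simp
      have hll : 1 - Real.log N / Real.log (N + 1 : ℕ) ≤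
          Real.log (Real.log (N + 1 : ℕ)) - Real.log (Real.log N) := by
        rw [← Real.log_div l2.ne' l1.ne']
        have := Real.one_sub_inv_le_log_of_pos (div_pos l2 l1)
        rwa [inv_div] at this
      have hdiff : 0 ≤ 1 / Real.log N - 1 / Real.log (N + 1 : ℕ) := by
        rw [sub_nonneg]
        exact one_div_le_one_div_of_le l1 l12
      have hmul := mul_le_mul_of_nonneg_right A hdiff
      have e1 : (Real.log N + c) * (1 / Real.log N - 1 / Real.log (N + 1 : ℕ)) =
          1 - Real.log N / Real.log (N + 1 : ℕ) + c / Real.log N - c / Real.log (N + 1 : ℕ) := by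
        field_simp; ring
      rw [e1] at hmul
      generalize (∑ p ∈ Nat.primesLE N, Real.log p / p) = a at *
      generalize (∑ p ∈ Nat.primesLE N, (1 : ℝ) / p) = b at *
      have e2 : a * (1 / Real.log N - 1 / Real.log (N + 1 : ℕ)) =
          a / Real.log N - a / Real.log (N + 1 : ℕ) := by ring
      rw [e2] at hmul
      rw [add_div]
      linarith
  refine ⟨1 + K, fun N hN => ?_⟩
  have l1 : 0 < Real.log N := Real.log_pos (by exact_mod_cast hN)
  have h1 := key N hN
  have h2 := div_le_div_of_nonneg_right (sum_log_div_prime_le (N := N) (by omega)) l1.le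
  rw [add_div, div_self l1.ne'] at h2
  linarith

lemma sum_one_div_mul_pred_le (N : ℕ) :
    ∑ p ∈ Nat.primesLE N, (1 : ℝ) / (p * (p - 1)) ≤ 1 := by
  have h1 : ∀ n : ℕ, ∑ p ∈ Finset.Ioc 1 (n + 1), (1 : ℝ) / (p * (p - 1)) =
      1 - 1 / (n + 1 : ℕ) := by
    intro n
    induction n with
    | zero => simp
    | succ n ih =>
      rw [← Finset.insert_Ioc_right_eq_Ioc_add_one (by omega), Finset.sum_insert (by simp), ih]
      push_cast
      have : (n : ℝ) + 1 + 1 ≠ 0 := by positivity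
      have : (n : ℝ) + 1 ≠ 0 := by positivity
      have e : (n : ℝ) + 1 + 1 - 1 = n + 1 := by ring
      rw [e]
      field_simp
      ring
  calc ∑ p ∈ Nat.primesLE N, (1 : ℝ) / (p * (p - 1))
      ≤ ∑ p ∈ Finset.Ioc 1 (N + 1), (1 : ℝ) / (p * (p - 1)) := by
        refine Finset.sum_le_sum_of_subset_of_nonneg (fun p hp => ?_) fun p hp _ => ?_
        · have := Nat.one_lt_of_mem_primesLE hp
          have := Nat.le_of_mem_primesLE hp
          simp only [Finset.mem_Ioc]; omega
        · have : (1 : ℝ) < p := by exact_mod_cast (Finset.mem_Ioc.1 hp).1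
          have : (0 : ℝ) < p - 1 := by linarith
          positivity
    _ ≤ 1 := by
        rw [h1]
        have : (0 : ℝ) ≤ 1 / (N + 1 : ℕ) := by positivity
        linarith

/-- An Euler product whose factors are `1 + 1/p + O(1/p²)` is `O(log N)`. The constant `12` is
large enough for `f p = p² / (p - 1)³`. -/
lemma exists_prod_one_add_le :
    ∃ C : ℝ, 0 < C ∧ ∀ f : ℕ → ℝ,
      (∀ p, p.Prime → 0 ≤ f p ∧ f p ≤ 1 / p + 12 * (1 / (p * (p - 1)))) →
      ∀ N : ℕ, 2 ≤ N → ∏ p ∈ Nat.primesLE N, (1 + f p) ≤ C * Real.log N := by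
  obtain ⟨K, hK⟩ := exists_sum_one_div_prime_le
  refine ⟨Real.exp (K + 12), Real.exp_pos _, fun f hf N hN => ?_⟩
  have l1 : 0 < Real.log N := Real.log_pos (by exact_mod_cast hN)
  calc ∏ p ∈ Nat.primesLE N, (1 + f p)
      ≤ ∏ p ∈ Nat.primesLE N, Real.exp (1 / p + 12 * (1 / (p * (p - 1)))) := by
        refine Finset.prod_le_prod (fun p hp => ?_) fun p hp => ?_
        · have := (hf p (Nat.prime_of_mem_primesLE hp)).1
          linarith
        · have := (hf p (Nat.prime_of_mem_primesLE hp)).2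
          have := Real.add_one_le_exp (1 / (p : ℝ) + 12 * (1 / (p * (p - 1))))
          linarith
    _ = Real.exp (∑ p ∈ Nat.primesLE N, (1 : ℝ) / p +
          12 * ∑ p ∈ Nat.primesLE N, (1 : ℝ) / (p * (p - 1))) := by
        rw [← Real.exp_sum, Finset.sum_add_distrib, Finset.mul_sum]
    _ ≤ Real.exp ((K + 12) + Real.log (Real.log N)) := by
        apply Real.exp_le_exp.2
        have := hK N hN
        have := sum_one_div_mul_pred_le N
        linarith
    _ = _ := by rw [Real.exp_add, Real.exp_log l1]

/-! ### Euler's function on squarefree numbers -/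

lemma totient_eq_prod_of_squarefree {n : ℕ} (hn : Squarefree n) :
    (Nat.totient n : ℝ) = ∏ p ∈ n.primeFactors, ((p : ℝ) - 1) := by
  have h := Nat.totient_mul_prod_primeFactors n
  rw [Nat.prod_primeFactors_of_squarefree hn, mul_comm] at h
  rw [Nat.eq_of_mul_eq_mul_left (Nat.pos_of_ne_zero hn.ne_zero) h, Nat.cast_prod]
  refine Finset.prod_congr rfl fun p hp => ?_
  rw [Nat.cast_sub (Nat.prime_of_mem_primeFactors hp).one_le, Nat.cast_one]

lemma natCast_eq_prod_of_squarefree {n : ℕ} (hn : Squarefree n) :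
    (n : ℝ) = ∏ p ∈ n.primeFactors, (p : ℝ) := by
  rw [← Nat.cast_prod, Nat.prod_primeFactors_of_squarefree hn]

lemma sum_divisors_le_prod (F : ℕ → ℝ) (f : ℕ → ℝ) {n : ℕ} (hn : Squarefree n)
    (hf : ∀ p ∈ n.primeFactors, 0 ≤ f p)
    (hF : ∀ d ∈ n.divisors, F d = ∏ p ∈ d.primeFactors, f p) :
    ∑ d ∈ n.divisors, F d ≤ ∏ p ∈ n.primeFactors, (1 + f p) := by
  rw [Finset.prod_one_add, Finset.sum_congr rfl hF]
  have inj : Set.InjOn Nat.primeFactors (n.divisors : Set ℕ) := by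
    intro a ha b hb hab
    have ha' := hn.squarefree_of_dvd (Nat.dvd_of_mem_divisors ha)
    have hb' := hn.squarefree_of_dvd (Nat.dvd_of_mem_divisors hb)
    rw [← Nat.prod_primeFactors_of_squarefree ha', ← Nat.prod_primeFactors_of_squarefree hb', hab]
  rw [← Finset.sum_image (f := fun t => ∏ p ∈ t, f p) inj]
  refine Finset.sum_le_sum_of_subset_of_nonneg ?_ fun t ht _ => ?_
  · intro t ht
    obtain ⟨d, hd, rfl⟩ := Finset.mem_image.1 ht
    exact Finset.mem_powerset.2
      (Nat.primeFactors_mono (Nat.dvd_of_mem_divisors hd) (Nat.ne_zero_of_mem_divisors hd))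
  · exact Finset.prod_nonneg fun p hp => hf p (Finset.mem_powerset.1 ht hp)

/-- `∑ d² / φ(d)³ ≪ log N` over the products `d` of distinct primes up to `N`. -/
lemma exists_sum_sq_div_totient_cube_le :
    ∃ C : ℝ, 0 < C ∧ ∀ N : ℕ, 2 ≤ N →
      ∑ d ∈ (primorial N).divisors, (d : ℝ) ^ 2 / (Nat.totient d : ℝ) ^ 3 ≤ C * Real.log N := by
  obtain ⟨C, hC, H⟩ := exists_prod_one_add_le
  refine ⟨C, hC, fun N hN => ?_⟩
  have hb : ∀ p : ℕ, p.Prime → 0 ≤ (p : ℝ) ^ 2 / ((p : ℝ) - 1) ^ 3 ∧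
      (p : ℝ) ^ 2 / ((p : ℝ) - 1) ^ 3 ≤ 1 / p + 12 * (1 / (p * (p - 1))) := by
    intro p hp
    have h2 : (2 : ℝ) ≤ p := by exact_mod_cast hp.two_le
    have h0 : (0 : ℝ) < p := by linarith
    have h1 : (0 : ℝ) < p - 1 := by linarith
    refine ⟨by positivity, ?_⟩
    have e : (1 : ℝ) / p + 12 * (1 / (p * (p - 1))) = (p + 11) / (p * (p - 1)) := by
      field_simp; ring
    rw [e, div_le_div_iff₀ (by positivity) (by positivity)]
    have : (p : ℝ) ^ 3 ≤ (p + 11) * (p - 1) ^ 2 := by nlinarith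
    nlinarith [mul_le_mul_of_nonneg_right this h1.le]
  refine le_trans ?_ (H _ hb N hN)
  rw [← primeFactors_primorial]
  refine sum_divisors_le_prod _ _ (squarefree_primorial N)
    (fun p hp => (hb p (Nat.prime_of_mem_primeFactors hp)).1) fun d hd => ?_
  have hd' := (squarefree_primorial N).squarefree_of_dvd (Nat.dvd_of_mem_divisors hd)
  rw [totient_eq_prod_of_squarefree hd', natCast_eq_prod_of_squarefree hd',
    Finset.prod_div_distrib, Finset.prod_pow, Finset.prod_pow]

lemma natLog_add_one_le {h : ℕ} (hh : 2 ≤ h) : ((Nat.log 2 h + 1 : ℕ) : ℝ) ≤ 4 * Real.log h := by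
  have hh' : (2 : ℝ) ≤ h := by exact_mod_cast hh
  have l2 : 1 / 2 < Real.log 2 := by have := Real.log_two_gt_d9; linarith
  have lh : Real.log 2 ≤ Real.log h := Real.log_le_log (by norm_num) hh'
  have h1 : (Nat.log 2 h : ℝ) * Real.log 2 ≤ Real.log h := by
    rw [← Real.log_pow]
    apply Real.log_le_log (by positivity)
    exact_mod_cast Nat.pow_log_le_self 2 (by omega)
  push_cast
  have : (0 : ℝ) ≤ Nat.log 2 h := Nat.cast_nonneg _
  nlinarith

/-- `x / φ(x) ≪ log log h` for squarefree `x ≤ h`. The primes dividing `x` that exceed `log₂ x`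
are too few to matter, and Mertens' bound handles the others. -/
lemma exists_div_totient_le :
    ∃ C : ℝ, 0 < C ∧ ∀ h x : ℕ, 2 ≤ h → x ≤ h → Squarefree x →
      (x : ℝ) / Nat.totient x ≤ C * (1 + |Real.log (Real.log h)|) := by
  obtain ⟨C, hC, H⟩ := exists_prod_one_add_le
  refine ⟨C * Real.exp 1 * 4, by positivity, fun h x hh hx hsq => ?_⟩
  -- `x` has at most `log₂ h < N` prime factors
  set N := Nat.log 2 h + 1 with hN
  have hN2 : 2 ≤ N := by
    have : 0 < Nat.log 2 h := Nat.log_pos (by norm_num) hh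
    omega
  have hN0 : (0 : ℝ) < N := by positivity
  set f : ℕ → ℝ := fun p => 1 / ((p : ℝ) - 1) with hf
  have hb : ∀ p : ℕ, p.Prime → 0 ≤ f p ∧ f p ≤ 1 / p + 12 * (1 / (p * (p - 1))) := by
    intro p hp
    have h2 : (2 : ℝ) ≤ p := by exact_mod_cast hp.two_le
    have h1 : (0 : ℝ) < p - 1 := by linarith
    refine ⟨by simp only [hf]; positivity, ?_⟩
    have e : (1 : ℝ) / p + 12 * (1 / (p * (p - 1))) = (p + 11) / (p * (p - 1)) := by
      field_simp; ring
    simp only [hf]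
    rw [e, div_le_div_iff₀ (by positivity) (by positivity)]
    nlinarith
  have ratio : (x : ℝ) / Nat.totient x = ∏ p ∈ x.primeFactors, (1 + f p) := by
    rw [totient_eq_prod_of_squarefree hsq]
    nth_rewrite 1 [natCast_eq_prod_of_squarefree hsq]
    rw [← Finset.prod_div_distrib]
    refine Finset.prod_congr rfl fun p hp => ?_
    have h2 : (2 : ℝ) ≤ p := by exact_mod_cast (Nat.prime_of_mem_primeFactors hp).two_le
    have h1 : (p : ℝ) - 1 ≠ 0 := by linarith
    simp only [hf]
    field_simp
    ring
  have one_le : ∀ p : ℕ, p.Prime → 1 ≤ 1 + f p := fun p hp => by linarith [(hb p hp).1]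
  have card : (x.primeFactors.card : ℝ) ≤ N := by
    have h1 : 2 ^ x.primeFactors.card ≤ x := by
      calc 2 ^ x.primeFactors.card = ∏ p ∈ x.primeFactors, 2 := by simp
        _ ≤ ∏ p ∈ x.primeFactors, p :=
          Finset.prod_le_prod' fun p hp => (Nat.prime_of_mem_primeFactors hp).two_le
        _ = x := Nat.prod_primeFactors_of_squarefree hsq
    have : x.primeFactors.card ≤ Nat.log 2 h := Nat.le_log_of_pow_le (by norm_num) (h1.trans hx)
    exact_mod_cast this.trans (Nat.le_succ _)
  have small : ∏ p ∈ x.primeFactors.filter (· ≤ N), (1 + f p) ≤ C * Real.log N := by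
    refine le_trans ?_ (H f hb N hN2)
    refine Finset.prod_le_prod_of_subset_of_one_le (fun p hp => ?_) (fun p hp => ?_)
      fun p hp _ => one_le p (Nat.prime_of_mem_primesLE hp)
    · have hp' := Finset.mem_filter.1 hp
      exact Nat.mem_primesLE.2 ⟨hp'.2, Nat.prime_of_mem_primeFactors hp'.1⟩
    · have := one_le p (Nat.prime_of_mem_primeFactors (Finset.mem_filter.1 hp).1)
      linarith
  have large : ∏ p ∈ x.primeFactors.filter (¬ · ≤ N), (1 + f p) ≤ Real.exp 1 := by
    calc _ ≤ ∏ p ∈ x.primeFactors.filter (¬ · ≤ N), Real.exp (1 / N) := by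
          refine Finset.prod_le_prod (fun p hp => ?_) fun p hp => ?_
          · have := one_le p (Nat.prime_of_mem_primeFactors (Finset.mem_filter.1 hp).1)
            linarith
          · have hp' := (Finset.mem_filter.1 hp).2
            have h1 : N + 1 ≤ p := by omega
            have h2 : (N : ℝ) + 1 ≤ p := by exact_mod_cast h1
            have h3 : f p ≤ 1 / N := one_div_le_one_div_of_le hN0 (by linarith)
            have := Real.add_one_le_exp (1 / (N : ℝ))
            linarith
      _ = Real.exp ((x.primeFactors.filter (¬ · ≤ N)).card * (1 / N)) := by
          rw [Finset.prod_const, Real.exp_nat_mul]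
      _ ≤ Real.exp 1 := by
          apply Real.exp_le_exp.2
          rw [mul_one_div, div_le_one hN0]
          refine le_trans ?_ card
          exact_mod_cast Finset.card_filter_le _ _
  have hlogN : Real.log N ≤ 4 * (1 + |Real.log (Real.log h)|) := by
    have hh' : (2 : ℝ) ≤ h := by exact_mod_cast hh
    have lh : 0 < Real.log h := Real.log_pos (by linarith)
    have h2 : (N : ℝ) ≤ 4 * Real.log h := natLog_add_one_le hh
    have h3 := Real.log_le_log hN0 h2
    rw [Real.log_mul (by norm_num) lh.ne'] at h3
    have h4 : Real.log 4 ≤ 4 := by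
      have := Real.log_le_sub_one_of_pos (show (0 : ℝ) < 4 by norm_num)
      linarith
    have h5 := le_abs_self (Real.log (Real.log h))
    have h6 := abs_nonneg (Real.log (Real.log h))
    linarith
  rw [ratio, ← Finset.prod_filter_mul_prod_filter_not _ (· ≤ N)]
  have lN : 0 ≤ Real.log N := Real.log_natCast_nonneg N
  calc _ ≤ (C * Real.log N) * Real.exp 1 := by
        refine mul_le_mul small large (Finset.prod_nonneg fun p hp => ?_) (by positivity)
        have := one_le p (Nat.prime_of_mem_primeFactors (Finset.mem_filter.1 hp).1)
        linarith
    _ ≤ (C * (4 * (1 + |Real.log (Real.log h)|))) * Real.exp 1 := by gcongr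
    _ = _ := by ring

/-! ### Triples of reduced fractions with integral sum -/

/-- The reduced numerators `1 ≤ a ≤ q`, `(a, q) = 1`. -/
def reducedNumerators (q : ℕ) : Finset ℕ := (Finset.Icc 1 q).filter fun a => Nat.Coprime a q

open Classical in
/-- The triples of reduced numerators over `q₁, q₂, q₃` whose fractions have integral sum. -/
noncomputable def fracTriples (q₁ q₂ q₃ : ℕ) : Finset (ℕ × ℕ × ℕ) :=
  (reducedNumerators q₁ ×ˢ reducedNumerators q₂ ×ˢ reducedNumerators q₃).filter fun t =>
    ∃ n : ℤ, (t.1 : ℝ) / q₁ + (t.2.1 : ℝ) / q₂ + (t.2.2 : ℝ) / q₃ = n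

lemma mem_fracTriples {q₁ q₂ q₃ : ℕ} {t : ℕ × ℕ × ℕ} :
    t ∈ fracTriples q₁ q₂ q₃ ↔ (t.1 ∈ reducedNumerators q₁ ∧ t.2.1 ∈ reducedNumerators q₂ ∧
      t.2.2 ∈ reducedNumerators q₃) ∧
      ∃ n : ℤ, (t.1 : ℝ) / q₁ + (t.2.1 : ℝ) / q₂ + (t.2.2 : ℝ) / q₃ = n := by
  simp [fracTriples]

lemma mem_reducedNumerators {q a : ℕ} :
    a ∈ reducedNumerators q ↔ (1 ≤ a ∧ a ≤ q) ∧ Nat.Coprime a q := by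
  simp [reducedNumerators]

lemma sum_fracTriples_swap₂₃ (q₁ q₂ q₃ : ℕ) (f : ℕ × ℕ × ℕ → ℝ) :
    ∑ t ∈ fracTriples q₁ q₂ q₃, f t =
      ∑ t ∈ fracTriples q₁ q₃ q₂, f (t.1, t.2.2, t.2.1) := by
  refine Finset.sum_nbij' (fun t => (t.1, t.2.2, t.2.1)) (fun t => (t.1, t.2.2, t.2.1))
    ?_ ?_ (fun _ _ => rfl) (fun _ _ => rfl) (fun _ _ => rfl) <;>
  · intro t ht
    rw [mem_fracTriples] at *
    obtain ⟨⟨h1, h2, h3⟩, n, hn⟩ := ht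
    exact ⟨⟨h1, h3, h2⟩, n, by rw [← hn]; ring⟩

lemma sum_fracTriples_swap₁₂ (q₁ q₂ q₃ : ℕ) (f : ℕ × ℕ × ℕ → ℝ) :
    ∑ t ∈ fracTriples q₁ q₂ q₃, f t =
      ∑ t ∈ fracTriples q₂ q₁ q₃, f (t.2.1, t.1, t.2.2) := by
  refine Finset.sum_nbij' (fun t => (t.2.1, t.1, t.2.2)) (fun t => (t.2.1, t.1, t.2.2))
    ?_ ?_ (fun _ _ => rfl) (fun _ _ => rfl) (fun _ _ => rfl) <;>
  · intro t ht
    rw [mem_fracTriples] at *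
    obtain ⟨⟨h1, h2, h3⟩, n, hn⟩ := ht
    exact ⟨⟨h2, h1, h3⟩, n, by rw [← hn]; ring⟩

lemma inv_le_div_of_mem_reducedNumerators {q a : ℕ} (hq : 1 < q)
    (ha : a ∈ reducedNumerators q) :
    (1 : ℝ) / q ≤ (a : ℝ) / q ∧ (1 : ℝ) / q ≤ 1 - (a : ℝ) / q := by
  rw [mem_reducedNumerators] at ha
  have hq0 : (0 : ℝ) < q := by positivity
  have h1 : (1 : ℝ) ≤ a := by exact_mod_cast ha.1.1
  have h2 : a ≠ q := by
    rintro rfl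
    have := (Nat.coprime_self a).1 ha.2
    omega
  have h3 : a + 1 ≤ q := by have := ha.1.2; omega
  have h3' : (a : ℝ) + 1 ≤ q := by exact_mod_cast h3
  refine ⟨by gcongr, ?_⟩
  rw [le_sub_iff_add_le, ← add_div, div_le_one hq0]
  linarith

lemma div_pos_of_mem_reducedNumerators {q a : ℕ} (hq : 1 < q) (ha : a ∈ reducedNumerators q) :
    0 < (a : ℝ) / q := by
  have hq0 : (0 : ℝ) < 1 / q := by positivity
  exact hq0.trans_le (inv_le_div_of_mem_reducedNumerators hq ha).1

lemma div_lt_one_of_mem_reducedNumerators {q a : ℕ} (hq : 1 < q)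
    (ha : a ∈ reducedNumerators q) : (a : ℝ) / q < 1 := by
  have hq0 : (0 : ℝ) < 1 / q := by positivity
  linarith [(inv_le_div_of_mem_reducedNumerators hq ha).2]

lemma eq_of_div_eq_div {q q' a a' : ℕ} (ha : a ∈ reducedNumerators q)
    (ha' : a' ∈ reducedNumerators q') (h : (a : ℝ) / q = (a' : ℝ) / q') : a = a' ∧ q = q' := by
  rw [mem_reducedNumerators] at ha ha'
  have hq : 0 < q := by omega
  have hq' : 0 < q' := by omega
  have hqr : (q : ℝ) ≠ 0 := by positivity
  have hqr' : (q' : ℝ) ≠ 0 := by positivity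
  rw [div_eq_div_iff hqr hqr'] at h
  have h' : a * q' = a' * q := by exact_mod_cast h
  have d1 : q ∣ q' := ha.2.symm.dvd_of_dvd_mul_left (Dvd.intro_left a' h'.symm)
  have d2 : q' ∣ q := ha'.2.symm.dvd_of_dvd_mul_left (Dvd.intro_left a h')
  have e := Nat.dvd_antisymm d1 d2
  subst e
  exact ⟨Nat.eq_of_mul_eq_mul_right hq h', rfl⟩

/-- Separation of the second fractions of two triples that share their first fraction. The
difference of the second fractions and that of the third ones are opposite modulo `1`, so their
common denominator divides both `g z [x, x']` and `g y [x, x']`, hence `g [x, x']`. -/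
lemma inv_le_abs_sub_of_fracTriples {g y z x x' : ℕ} {t t' : ℕ × ℕ × ℕ} (hyz : Nat.Coprime y z)
    (h₁ : 1 < g * x * y) (h₁' : 1 < g * x' * y)
    (ht : t ∈ fracTriples (g * y * z) (g * x * z) (g * x * y))
    (ht' : t' ∈ fracTriples (g * y * z) (g * x' * z) (g * x' * y))
    (h1 : t.1 = t'.1) (hne : (x, t) ≠ (x', t')) :
    1 / ((g * Nat.lcm x x' : ℕ) : ℝ) ≤
      |(t.2.1 : ℝ) / (g * x * z : ℕ) - (t'.2.1 : ℝ) / (g * x' * z : ℕ)| := by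
  rw [mem_fracTriples] at ht ht'
  obtain ⟨⟨ha, hb, hc⟩, n, hn⟩ := ht
  obtain ⟨⟨ha', hb', hc'⟩, n', hn'⟩ := ht'
  obtain ⟨e, he⟩ := Nat.dvd_lcm_left x x'
  obtain ⟨e', he'⟩ := Nat.dvd_lcm_right x x'
  have hb0 := mem_reducedNumerators.1 hb
  have hb0' := mem_reducedNumerators.1 hb'
  have hP : 0 < g * x * z := by omega
  have hP' : 0 < g * x' * z := by omega
  have hg : 0 < g := Nat.pos_of_ne_zero fun h => by simp [h] at hP
  have hx : 0 < x := Nat.pos_of_ne_zero fun h => by simp [h] at hP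
  have hx' : 0 < x' := Nat.pos_of_ne_zero fun h => by simp [h] at hP'
  have hz : 0 < z := Nat.pos_of_ne_zero fun h => by simp [h] at hP
  have hy : 0 < y := Nat.pos_of_ne_zero fun h => by simp [h] at h₁
  have hm : 0 < Nat.lcm x x' := Nat.lcm_pos hx hx'
  set m := Nat.lcm x x' with hmdef
  set D : ℝ := (t.2.1 : ℝ) / (g * x * z : ℕ) - (t'.2.1 : ℝ) / (g * x' * z : ℕ) with hD
  have hm1 : (m : ℝ) = x * e := by exact_mod_cast he
  have hm2 : (m : ℝ) = x' * e' := by exact_mod_cast he'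
  have gR : (0 : ℝ) < g := by exact_mod_cast hg
  have xR : (0 : ℝ) < x := by exact_mod_cast hx
  have xR' : (0 : ℝ) < x' := by exact_mod_cast hx'
  have yR : (0 : ℝ) < y := by exact_mod_cast hy
  have zR : (0 : ℝ) < z := by exact_mod_cast hz
  have mR : (0 : ℝ) < m := by exact_mod_cast hm
  have D1 : D * (g * z * m) = t.2.1 * e - t'.2.1 * e' := by
    have a1 : (t.2.1 : ℝ) / (g * x * z : ℕ) * (g * z * m) = t.2.1 * e := by
      rw [hm1]; push_cast; field_simp
    have a2 : (t'.2.1 : ℝ) / (g * x' * z : ℕ) * (g * z * m) = t'.2.1 * e' := by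
      rw [hm2]; push_cast; field_simp
    rw [hD, sub_mul, a1, a2]
  have D2' : D = (n - n') - ((t.2.2 : ℝ) / (g * x * y : ℕ) - (t'.2.2 : ℝ) / (g * x' * y : ℕ)) := by
    rw [h1] at hn
    rw [hD]
    linarith
  have D2 : D * (g * y * m) = (n - n') * (g * y * m) - (t.2.2 * e - t'.2.2 * e') := by
    have a1 : (t.2.2 : ℝ) / (g * x * y : ℕ) * (g * y * m) = t.2.2 * e := by
      rw [hm1]; push_cast; field_simp
    have a2 : (t'.2.2 : ℝ) / (g * x' * y : ℕ) * (g * y * m) = t'.2.2 * e' := by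
      rw [hm2]; push_cast; field_simp
    rw [D2', ← a1, ← a2]
    ring
  -- Bézout's identity for the coprime `y` and `z`
  have bez : (1 : ℝ) = y * (Nat.gcdA y z : ℝ) + z * (Nat.gcdB y z : ℝ) := by
    have := Nat.gcd_eq_gcd_ab y z
    rw [hyz.gcd_eq_one] at this
    exact_mod_cast this
  obtain ⟨k, hk⟩ : ∃ k : ℤ, D * (g * m : ℕ) = k := by
    refine ⟨Nat.gcdA y z * ((n - n') * (g * y * m) - (t.2.2 * e - t'.2.2 * e')) +
      Nat.gcdB y z * (t.2.1 * e - t'.2.1 * e'), ?_⟩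
    push_cast
    rw [← D1, ← D2]
    calc D * (g * m) = D * (g * m) * 1 := by ring
      _ = _ := by rw [bez]; ring
  have gm : (0 : ℝ) < (g * m : ℕ) := by positivity
  by_cases hk0 : k = 0
  · exfalso
    rw [hk0, Int.cast_zero] at hk
    have hD0 : D = 0 := (mul_eq_zero.1 hk).resolve_right gm.ne'
    obtain ⟨e1, e2⟩ := eq_of_div_eq_div hb hb' (sub_eq_zero.1 hD0)
    have exx : x = x' := by
      have := Nat.eq_of_mul_eq_mul_right hz e2
      exact Nat.eq_of_mul_eq_mul_left hg this
    subst exx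
    have c1 := div_pos_of_mem_reducedNumerators h₁ hc
    have c2 := div_lt_one_of_mem_reducedNumerators h₁ hc
    have c3 := div_pos_of_mem_reducedNumerators h₁ hc'
    have c4 := div_lt_one_of_mem_reducedNumerators h₁ hc'
    rw [hD0] at D2'
    have i1 : ((n - n' : ℤ) : ℝ) < 1 := by push_cast; linarith
    have i2 : (-1 : ℝ) < ((n - n' : ℤ) : ℝ) := by push_cast; linarith
    have i3 : n - n' < 1 := by exact_mod_cast i1
    have i4 : -1 < n - n' := by exact_mod_cast i2
    have i5 : n = n' := by omega
    rw [i5] at D2'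
    obtain ⟨e3, -⟩ := eq_of_div_eq_div hc hc' (by linarith)
    exact hne (Prod.ext rfl (Prod.ext h1 (Prod.ext e1 e3)))
  · have hk1 : (1 : ℝ) ≤ |(k : ℝ)| := by
      rw [← Int.cast_abs]
      exact_mod_cast Int.one_le_abs hk0
    rw [← hk, abs_mul, abs_of_pos gm] at hk1
    rwa [div_le_iff₀ gm]

/-- The sum of the product of the first two decay factors, over triples whose third parameter
`x` varies in a finite set. The first fractions are spaced by `1 / (g y z)`, and for a fixed
first fraction the second ones are spaced by `1 / Δ`. -/
lemma sum_decay_mul_decay_le {g y z : ℕ} {h Δ : ℝ} (hh : 0 < h) (hyz : Nat.Coprime y z)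
    (X : Finset ℕ) (hq : 1 < g * y * z) (hX : ∀ x ∈ X, 1 < g * x * z ∧ 1 < g * x * y)
    (hΔ : ∀ x ∈ X, ∀ x' ∈ X, ((g * Nat.lcm x x' : ℕ) : ℝ) ≤ Δ) (hΔ0 : 0 < Δ)
    (hmin : h ≤ Δ ∨ ∀ x ∈ X, ((g * x * z : ℕ) : ℝ) ≤ Δ) :
    ∑ x ∈ X, ∑ t ∈ fracTriples (g * y * z) (g * x * z) (g * x * y),
      decay h (circDist (t.1 / (g * y * z : ℕ))) * decay h (circDist (t.2.1 / (g * x * z : ℕ))) ≤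
      36 * (g * y * z : ℕ) * Δ / h ^ 2 := by
  set q := g * y * z with hqdef
  have hq0 : (0 : ℝ) < q := by positivity
  set S : Finset (Σ _ : ℕ, ℕ × ℕ × ℕ) :=
    X.sigma fun x => fracTriples q (g * x * z) (g * x * y) with hS
  have hmem : ∀ s ∈ S, s.1 ∈ X ∧ s.2 ∈ fracTriples q (g * s.1 * z) (g * s.1 * y) := fun s hs =>
    Finset.mem_sigma.1 hs
  have outer : ∑ a ∈ reducedNumerators q, decay h (circDist (a / q)) ≤ 6 / (h * (1 / q)) := by
    refine sum_decay_circDist_le _ (fun a : ℕ => (a : ℝ) / q) hh (by positivity)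
      (fun a ha => (div_pos_of_mem_reducedNumerators hq ha).le)
      (fun a ha => (div_lt_one_of_mem_reducedNumerators hq ha).le) (fun a _ b _ hab => ?_)
      (Or.inr fun a ha => inv_le_div_of_mem_reducedNumerators hq ha)
    rw [← sub_div, abs_div, abs_of_pos hq0]
    gcongr
    have : ((a : ℤ) - b) ≠ 0 := by omega
    have := Int.one_le_abs this
    exact_mod_cast this
  have inner : ∀ a, ∑ s ∈ S.filter (fun s => s.2.1 = a),
      decay h (circDist (s.2.2.1 / (g * s.1 * z : ℕ))) ≤ 6 / (h * (1 / Δ)) := by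
    intro a
    have mem : ∀ s ∈ S.filter (fun s => s.2.1 = a), s.2.1 = a ∧ s.1 ∈ X ∧
        s.2 ∈ fracTriples q (g * s.1 * z) (g * s.1 * y) ∧
        s.2.2.1 ∈ reducedNumerators (g * s.1 * z) := fun s hs => by
      obtain ⟨h1, h2⟩ := Finset.mem_filter.1 hs
      obtain ⟨h3, h4⟩ := hmem s h1
      exact ⟨h2, h3, h4, (mem_fracTriples.1 h4).1.2.1⟩
    refine sum_decay_circDist_le _
      (fun s : (Σ _ : ℕ, ℕ × ℕ × ℕ) => (s.2.2.1 : ℝ) / (g * s.1 * z : ℕ)) hh (by positivity)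
      (fun s hs => ?_) (fun s hs => ?_) (fun s hs s' hs' hne => ?_) ?_
    · obtain ⟨-, h2, -, h4⟩ := mem s hs
      exact (div_pos_of_mem_reducedNumerators (hX _ h2).1 h4).le
    · obtain ⟨-, h2, -, h4⟩ := mem s hs
      exact (div_lt_one_of_mem_reducedNumerators (hX _ h2).1 h4).le
    · obtain ⟨h1, h2, h3, -⟩ := mem s hs
      obtain ⟨h1', h2', h3', -⟩ := mem s' hs'
      have hne' : (s.1, s.2) ≠ (s'.1, s'.2) := fun e => hne (by
        obtain ⟨x, t⟩ := s
        obtain ⟨x', t'⟩ := s'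
        simp only [Prod.mk.injEq] at e
        obtain ⟨rfl, rfl⟩ := e
        rfl)
      refine le_trans ?_ (inv_le_abs_sub_of_fracTriples hyz (hX _ h2).2 (hX _ h2').2 h3 h3'
        (h1.trans h1'.symm) hne')
      have hpos : 0 < g * Nat.lcm s.1 s'.1 := by
        have a1 := (hX _ h2).2
        have a2 := (hX _ h2').2
        have hg : 0 < g := Nat.pos_of_ne_zero fun h => by simp [h] at a1
        have hx : 0 < s.1 := Nat.pos_of_ne_zero fun h => by simp [h] at a1
        have hx' : 0 < s'.1 := Nat.pos_of_ne_zero fun h => by simp [h] at a2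
        exact Nat.mul_pos hg (Nat.lcm_pos hx hx')
      exact one_div_le_one_div_of_le (by exact_mod_cast hpos) (hΔ _ h2 _ h2')
    · refine hmin.imp (fun H => ?_) fun H s hs => ?_
      · rw [mul_one_div, div_le_one hΔ0]; exact H
      · obtain ⟨-, h2, -, h4⟩ := mem s hs
        have h5 := inv_le_div_of_mem_reducedNumerators (hX _ h2).1 h4
        have h6 : 1 / Δ ≤ 1 / ((g * s.1 * z : ℕ) : ℝ) := by
          have := (hX _ h2).1
          exact one_div_le_one_div_of_le (by positivity) (H _ h2)
        exact ⟨h6.trans h5.1, h6.trans h5.2⟩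
  have maps : ∀ s ∈ S, s.2.1 ∈ reducedNumerators q := fun s hs =>
    (mem_fracTriples.1 (hmem s hs).2).1.1
  calc _ = ∑ s ∈ S, decay h (circDist (s.2.1 / q)) *
        decay h (circDist (s.2.2.1 / (g * s.1 * z : ℕ))) := by
        rw [hS, Finset.sum_sigma]
    _ = ∑ a ∈ reducedNumerators q, decay h (circDist (a / q)) *
          ∑ s ∈ S.filter (fun s => s.2.1 = a),
            decay h (circDist (s.2.2.1 / (g * s.1 * z : ℕ))) := by
        rw [← Finset.sum_fiberwise_of_maps_to maps]
        refine Finset.sum_congr rfl fun a _ => ?_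
        rw [Finset.mul_sum]
        refine Finset.sum_congr rfl fun s hs => ?_
        rw [(Finset.mem_filter.1 hs).2]
    _ ≤ ∑ a ∈ reducedNumerators q, decay h (circDist (a / q)) * (6 / (h * (1 / Δ))) :=
        Finset.sum_le_sum fun a _ => mul_le_mul_of_nonneg_left (inner a) (decay_nonneg _ _)
    _ = (∑ a ∈ reducedNumerators q, decay h (circDist (a / q))) * (6 / (h * (1 / Δ))) := by
        rw [Finset.sum_mul]
    _ ≤ 6 / (h * (1 / q)) * (6 / (h * (1 / Δ))) := by gcongr
    _ = _ := by field_simp; ring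

/-- The sum of `∏ (1 + h ‖aᵢ / qᵢ‖)⁻¹` over triples of reduced fractions with integral sum. -/
noncomputable def tripleSum (h : ℝ) (q₁ q₂ q₃ : ℕ) : ℝ :=
  ∑ t ∈ fracTriples q₁ q₂ q₃, 1 / ((1 + h * circDist (t.1 / q₁)) *
    (1 + h * circDist (t.2.1 / q₂)) * (1 + h * circDist (t.2.2 / q₃)))

lemma tripleSum_swap₁₂ (h : ℝ) (q₁ q₂ q₃ : ℕ) : tripleSum h q₁ q₂ q₃ = tripleSum h q₂ q₁ q₃ := by
  unfold tripleSum
  rw [sum_fracTriples_swap₁₂]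
  exact Finset.sum_congr rfl fun t _ => by congr 2; ring

lemma tripleSum_swap₂₃ (h : ℝ) (q₁ q₂ q₃ : ℕ) : tripleSum h q₁ q₂ q₃ = tripleSum h q₁ q₃ q₂ := by
  unfold tripleSum
  rw [sum_fracTriples_swap₂₃]
  exact Finset.sum_congr rfl fun t _ => by congr 1; ring

/-- The main estimate for the triples of fractions. In both alternatives of the last hypothesis,
the triples are as many as equidistribution predicts. -/
lemma sum_tripleSum_le {g y z : ℕ} {h Δ : ℝ} (hh : 0 < h) (hyz : Nat.Coprime y z)
    (X : Finset ℕ) (hq : 1 < g * y * z) (hX : ∀ x ∈ X, 1 < g * x * z ∧ 1 < g * x * y)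
    (hΔ : ∀ x ∈ X, ∀ x' ∈ X, ((g * Nat.lcm x x' : ℕ) : ℝ) ≤ Δ) (hΔ0 : 0 < Δ)
    (hmin : h ≤ Δ ∨ ∀ x ∈ X, ((g * x * z : ℕ) : ℝ) ≤ Δ ∧ ((g * x * y : ℕ) : ℝ) ≤ Δ) :
    ∑ x ∈ X, tripleSum h (g * y * z) (g * x * z) (g * x * y) ≤
      144 * (g * y * z : ℕ) * Δ / h ^ 2 := by
  have b1 := sum_decay_mul_decay_le hh hyz X hq hX hΔ hΔ0
    (hmin.imp_right fun H x hx => (H x hx).1)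
  have comm : g * z * y = g * y * z := by ring
  have b2 := sum_decay_mul_decay_le hh hyz.symm X (by rwa [comm]) (fun x hx => (hX x hx).symm)
    hΔ hΔ0 (hmin.imp_right fun H x hx => (H x hx).2)
  rw [comm] at b2
  have step : ∀ x ∈ X, tripleSum h (g * y * z) (g * x * z) (g * x * y) ≤
      2 * (∑ t ∈ fracTriples (g * y * z) (g * x * z) (g * x * y),
        decay h (circDist (t.1 / (g * y * z : ℕ))) *
          decay h (circDist (t.2.1 / (g * x * z : ℕ))) +
        ∑ t ∈ fracTriples (g * y * z) (g * x * y) (g * x * z),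
        decay h (circDist (t.1 / (g * y * z : ℕ))) *
          decay h (circDist (t.2.1 / (g * x * y : ℕ)))) := by
    intro x hx
    rw [sum_fracTriples_swap₂₃ (g * y * z) (g * x * y) (g * x * z), ← Finset.sum_add_distrib,
      Finset.mul_sum]
    refine Finset.sum_le_sum fun t ht => ?_
    obtain ⟨⟨m1, m2, m3⟩, hn⟩ := mem_fracTriples.1 ht
    have hx2 := (hX x hx).1
    have hx3 := (hX x hx).2
    exact prod_le_decay hh.le (div_pos_of_mem_reducedNumerators hq m1)
      (div_lt_one_of_mem_reducedNumerators hq m1) (div_pos_of_mem_reducedNumerators hx2 m2)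
      (div_lt_one_of_mem_reducedNumerators hx2 m2) (div_pos_of_mem_reducedNumerators hx3 m3)
      (div_lt_one_of_mem_reducedNumerators hx3 m3) hn
  refine (Finset.sum_le_sum step).trans ?_
  rw [← Finset.mul_sum, Finset.sum_add_distrib]
  have e : 144 * (g * y * z : ℕ) * Δ / h ^ 2 =
      2 * (36 * (g * y * z : ℕ) * Δ / h ^ 2 + 36 * (g * y * z : ℕ) * Δ / h ^ 2) := by ring
  rw [e]
  gcongr

/-! ### Parametrization of the denominators -/

/-- In a triple of reduced fractions with integral sum, the first denominator divides every
common multiple of the other two. -/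
lemma dvd_of_mem_fracTriples {q₁ q₂ q₃ : ℕ} {t : ℕ × ℕ × ℕ} (ht : t ∈ fracTriples q₁ q₂ q₃)
    {L : ℕ} (h2 : q₂ ∣ L) (h3 : q₃ ∣ L) : q₁ ∣ L := by
  obtain ⟨⟨m1, m2, m3⟩, n, hn⟩ := mem_fracTriples.1 ht
  rw [mem_reducedNumerators] at m1 m2 m3
  obtain ⟨u, rfl⟩ := h2
  obtain ⟨v, hv⟩ := h3
  have r1 : (q₁ : ℝ) ≠ 0 := by have : 0 < q₁ := by omega
                               positivity
  have r2 : (q₂ : ℝ) ≠ 0 := by have : 0 < q₂ := by omega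
                               positivity
  have r3 : (q₃ : ℝ) ≠ 0 := by have : 0 < q₃ := by omega
                               positivity
  have hvR : (q₂ : ℝ) * u = q₃ * v := by exact_mod_cast hv
  have key : (t.1 : ℝ) * (q₂ * u) = q₁ * (n * (q₂ * u) - t.2.1 * u - t.2.2 * v) := by
    have e1 : (t.1 : ℝ) = q₁ * (n - t.2.1 / q₂ - t.2.2 / q₃) := by
      rw [← hn]; field_simp; ring
    have e2 : (t.2.1 : ℝ) / q₂ * (q₂ * u) = t.2.1 * u := by field_simp
    have e3 : (t.2.2 : ℝ) / q₃ * (q₂ * u) = t.2.2 * v := by rw [hvR]; field_simp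
    rw [← e2, ← e3, e1]
    ring
  have keyZ : (t.1 : ℤ) * ((q₂ * u : ℕ) : ℤ) = q₁ * (n * (q₂ * u) - t.2.1 * u - t.2.2 * v) := by
    have : (((t.1 : ℤ) * ((q₂ * u : ℕ) : ℤ) : ℤ) : ℝ) =
        ((q₁ * (n * (q₂ * u) - t.2.1 * u - t.2.2 * v) : ℤ) : ℝ) := by
      push_cast
      exact key
    exact_mod_cast this
  have hd : (q₁ : ℤ) ∣ ((t.1 * (q₂ * u) : ℕ) : ℤ) := ⟨_, by push_cast at keyZ ⊢; exact keyZ⟩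
  exact m1.2.symm.dvd_of_dvd_mul_left (Int.natCast_dvd_natCast.1 hd)

/-- Denominators of three reduced fractions with integral sum have the form
`g y z`, `g x z`, `g x y`. -/
lemma exists_param_of_mem_fracTriples {q₁ q₂ q₃ : ℕ} {t : ℕ × ℕ × ℕ}
    (ht : t ∈ fracTriples q₁ q₂ q₃) :
    ∃ g x y z : ℕ, q₁ = g * y * z ∧ q₂ = g * x * z ∧ q₃ = g * x * y := by
  have d1 : ∀ L, q₂ ∣ L → q₃ ∣ L → q₁ ∣ L := fun L => dvd_of_mem_fracTriples ht
  have d2 : ∀ L, q₁ ∣ L → q₃ ∣ L → q₂ ∣ L := fun L => by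
    refine dvd_of_mem_fracTriples (t := (t.2.1, t.1, t.2.2)) ?_
    obtain ⟨⟨m1, m2, m3⟩, n, hn⟩ := mem_fracTriples.1 ht
    exact mem_fracTriples.2 ⟨⟨m2, m1, m3⟩, n, by rw [← hn]; ring⟩
  have d3 : ∀ L, q₁ ∣ L → q₂ ∣ L → q₃ ∣ L := fun L => by
    refine dvd_of_mem_fracTriples (t := (t.2.2, t.1, t.2.1)) ?_
    obtain ⟨⟨m1, m2, m3⟩, n, hn⟩ := mem_fracTriples.1 ht
    exact mem_fracTriples.2 ⟨⟨m3, m1, m2⟩, n, by rw [← hn]; ring⟩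
  obtain ⟨⟨m1, m2, m3⟩, -⟩ := mem_fracTriples.1 ht
  rw [mem_reducedNumerators] at m1 m2 m3
  have p1 : 0 < q₁ := by omega
  have p2 : 0 < q₂ := by omega
  obtain ⟨A, b, c, hA, hbc, rfl, rfl⟩ := Nat.exists_coprime' (Nat.gcd_pos_of_pos_left q₃ p2)
  obtain ⟨g, m, x, hg, hmx, rfl, rfl⟩ := Nat.exists_coprime' (Nat.gcd_pos_of_pos_left A p1)
  have hx : 0 < x := Nat.pos_of_ne_zero fun h => by simp [h] at hA
  have k1 : m ∣ b * c := by
    have := d1 (g * (x * (b * c))) ⟨c, by ring⟩ ⟨b, by ring⟩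
    rw [mul_comm m g] at this
    exact hmx.dvd_of_dvd_mul_left (Nat.dvd_of_mul_dvd_mul_left hg this)
  have k2 : b ∣ m := by
    have := d2 (g * x * (c * m)) ⟨x * c, by ring⟩ ⟨m, by ring⟩
    have e : b * (x * g) = g * x * b := by ring
    rw [e] at this
    exact hbc.dvd_of_dvd_mul_left (Nat.dvd_of_mul_dvd_mul_left (Nat.mul_pos hg hx) this)
  have k3 : c ∣ m := by
    have := d3 (g * x * (b * m)) ⟨x * b, by ring⟩ ⟨m, by ring⟩
    have e : c * (x * g) = g * x * c := by ring
    rw [e] at this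
    exact hbc.symm.dvd_of_dvd_mul_left (Nat.dvd_of_mul_dvd_mul_left (Nat.mul_pos hg hx) this)
  have k4 : m = b * c := Nat.dvd_antisymm k1 (hbc.mul_dvd_of_dvd_of_dvd k2 k3)
  exact ⟨g, x, c, b, by rw [k4]; ring, by ring, by ring⟩

/-- The parameters of the triples of denominators: `g y z`, `g x z`, `g x y` are squarefree (so
that `g, x, y, z` are pairwise coprime) and exceed `1`. -/
def IsAdmissible (g x y z : ℕ) : Prop :=
  (Squarefree (g * y * z) ∧ Squarefree (g * x * z) ∧ Squarefree (g * x * y)) ∧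
    1 < g * y * z ∧ 1 < g * x * z ∧ 1 < g * x * y

lemma IsAdmissible.swap_xy {g x y z : ℕ} (H : IsAdmissible g x y z) :
    IsAdmissible g y x z := by
  obtain ⟨⟨h1, h2, h3⟩, h4, h5, h6⟩ := H
  have e : g * x * y = g * y * x := by ring
  rw [e] at h3 h6
  exact ⟨⟨h2, h1, h3⟩, h5, h4, h6⟩

lemma IsAdmissible.swap_xz {g x y z : ℕ} (H : IsAdmissible g x y z) :
    IsAdmissible g z y x := by
  obtain ⟨⟨h1, h2, h3⟩, h4, h5, h6⟩ := H
  have e1 : g * y * z = g * z * y := by ring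
  have e2 : g * x * z = g * z * x := by ring
  have e3 : g * x * y = g * y * x := by ring
  rw [e1] at h1 h4
  rw [e2] at h2 h5
  rw [e3] at h3 h6
  exact ⟨⟨h3, h2, h1⟩, h6, h5, h4⟩

lemma IsAdmissible.pos {g x y z : ℕ} (H : IsAdmissible g x y z) :
    0 < g ∧ 0 < x ∧ 0 < y ∧ 0 < z := by
  obtain ⟨-, h4, h5, -⟩ := H
  refine ⟨?_, ?_, ?_, ?_⟩ <;> refine Nat.pos_of_ne_zero fun h => ?_ <;> simp [h] at h4 h5

lemma IsAdmissible.coprime_yz {g x y z : ℕ} (H : IsAdmissible g x y z) : Nat.Coprime y z := by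
  have h1 := H.1.1
  rw [mul_assoc, Nat.squarefree_mul_iff, Nat.squarefree_mul_iff] at h1
  exact h1.2.2.1

lemma IsAdmissible.squarefree_x {g x y z : ℕ} (H : IsAdmissible g x y z) : Squarefree x := by
  have h1 := H.1.2.1
  rw [mul_assoc, Nat.squarefree_mul_iff, Nat.squarefree_mul_iff] at h1
  exact h1.2.2.2.1

/-- The term of the singular series with parameters `g, x, y, z`. -/
noncomputable def paramTerm (h : ℝ) (g x y z : ℕ) : ℝ :=
  tripleSum h (g * y * z) (g * x * z) (g * x * y) /
    (Nat.totient (g * y * z) * Nat.totient (g * x * z) * Nat.totient (g * x * y))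

lemma circDist_nonneg_of_mem_reducedNumerators {q a : ℕ} (ha : a ∈ reducedNumerators q) :
    0 ≤ circDist ((a : ℝ) / q) := by
  have h1 := (mem_reducedNumerators.1 ha).1.2
  have h2 : (a : ℝ) / q ≤ 1 := div_le_one_of_le₀ (by exact_mod_cast h1) (Nat.cast_nonneg _)
  exact le_min (by positivity) (by linarith)

lemma tripleSum_nonneg {h : ℝ} (hh : 0 ≤ h) (q₁ q₂ q₃ : ℕ) : 0 ≤ tripleSum h q₁ q₂ q₃ := by
  refine Finset.sum_nonneg fun t ht => ?_
  obtain ⟨⟨m1, m2, m3⟩, -⟩ := mem_fracTriples.1 ht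
  have := circDist_nonneg_of_mem_reducedNumerators m1
  have := circDist_nonneg_of_mem_reducedNumerators m2
  have := circDist_nonneg_of_mem_reducedNumerators m3
  positivity

lemma paramTerm_nonneg {h : ℝ} (hh : 0 ≤ h) (g x y z : ℕ) : 0 ≤ paramTerm h g x y z := by
  have := tripleSum_nonneg hh (g * y * z) (g * x * z) (g * x * y)
  unfold paramTerm
  positivity

lemma paramTerm_swap_xy (h : ℝ) (g x y z : ℕ) : paramTerm h g x y z = paramTerm h g y x z := by
  unfold paramTerm
  have e : g * x * y = g * y * x := by ring
  rw [tripleSum_swap₁₂, e]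
  ring

lemma paramTerm_swap_xz (h : ℝ) (g x y z : ℕ) : paramTerm h g x y z = paramTerm h g z y x := by
  unfold paramTerm
  have e1 : g * y * z = g * z * y := by ring
  have e2 : g * x * z = g * z * x := by ring
  have e3 : g * x * y = g * y * x := by ring
  rw [tripleSum_swap₁₂, tripleSum_swap₂₃, tripleSum_swap₁₂, e1, e2, e3]
  ring

lemma paramTerm_eq {g x y z : ℕ} (H : IsAdmissible g x y z) (h : ℝ) :
    paramTerm h g x y z = tripleSum h (g * y * z) (g * x * z) (g * x * y) /
      ((Nat.totient g : ℝ) ^ 3 * (Nat.totient x : ℝ) ^ 2 * (Nat.totient y : ℝ) ^ 2 *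
        (Nat.totient z : ℝ) ^ 2) := by
  obtain ⟨⟨h1, h2, h3⟩, -⟩ := H
  rw [Nat.squarefree_mul_iff, Nat.squarefree_mul_iff] at h1 h2 h3
  unfold paramTerm
  rw [Nat.totient_mul h1.1, Nat.totient_mul h1.2.1.1, Nat.totient_mul h2.1,
    Nat.totient_mul h2.2.1.1, Nat.totient_mul h3.1, Nat.totient_mul h3.2.1.1]
  push_cast
  congr 1
  ring

/-! ### Bounds for the terms of the singular series -/

/-- The weight `d² / φ(d)³`, of size `1 / d` on average. -/
noncomputable def totientWeight (d : ℕ) : ℝ := (d : ℝ) ^ 2 / (Nat.totient d : ℝ) ^ 3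

lemma totientWeight_nonneg (d : ℕ) : 0 ≤ totientWeight d := by unfold totientWeight; positivity

lemma div_totient_sq_le_totientWeight {d : ℕ} (hd : 0 < d) :
    (d : ℝ) / (Nat.totient d : ℝ) ^ 2 ≤ totientWeight d := by
  have h1 : (0 : ℝ) < Nat.totient d := by exact_mod_cast Nat.totient_pos.2 hd
  have h2 : (Nat.totient d : ℝ) ≤ d := by exact_mod_cast Nat.totient_le d
  unfold totientWeight
  rw [div_le_div_iff₀ (by positivity) (by positivity)]
  have : (d : ℝ) * (Nat.totient d : ℝ) ^ 2 * Nat.totient d ≤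
      d * (Nat.totient d : ℝ) ^ 2 * d := by gcongr
  nlinarith

/-- If the fractions with denominator `g x` are denser than `1 / h`, each term has the size that
equidistribution predicts. -/
lemma paramTerm_le_of_le {g x y z : ℕ} (H : IsAdmissible g x y z) {h : ℝ} (hh : 0 < h)
    (hgx : h ≤ (g * x : ℕ)) :
    paramTerm h g x y z ≤ 144 / h ^ 2 *
      (totientWeight g * totientWeight x * totientWeight y * totientWeight z) := by
  obtain ⟨pg, px, py, pz⟩ := H.pos
  have fg : (0 : ℝ) < Nat.totient g := by exact_mod_cast Nat.totient_pos.2 pg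
  have fx : (0 : ℝ) < Nat.totient x := by exact_mod_cast Nat.totient_pos.2 px
  have fy : (0 : ℝ) < Nat.totient y := by exact_mod_cast Nat.totient_pos.2 py
  have fz : (0 : ℝ) < Nat.totient z := by exact_mod_cast Nat.totient_pos.2 pz
  have b := sum_tripleSum_le (g := g) (y := y) (z := z) (Δ := (g * x : ℕ)) hh H.coprime_yz {x}
    H.2.1 (by simpa using H.2.2) (by simp) (by positivity) (Or.inl hgx)
  rw [Finset.sum_singleton] at b
  rw [paramTerm_eq H]
  have wx := div_totient_sq_le_totientWeight px
  have wy := div_totient_sq_le_totientWeight py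
  have wz := div_totient_sq_le_totientWeight pz
  have wg := totientWeight_nonneg g
  have wx0 := totientWeight_nonneg x
  have wy0 := totientWeight_nonneg y
  calc _ ≤ (144 * (g * y * z : ℕ) * (g * x : ℕ) / h ^ 2) /
        ((Nat.totient g : ℝ) ^ 3 * (Nat.totient x : ℝ) ^ 2 * (Nat.totient y : ℝ) ^ 2 *
        (Nat.totient z : ℝ) ^ 2) := by gcongr
    _ = 144 / h ^ 2 * (totientWeight g * (x / (Nat.totient x : ℝ) ^ 2) *
        (y / (Nat.totient y : ℝ) ^ 2) * (z / (Nat.totient z : ℝ) ^ 2)) := by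
        unfold totientWeight
        push_cast
        field_simp
    _ ≤ _ := by gcongr

/-- The terms with `x` in a dyadic block `[2 ^ k, 2 ^ (k + 1))` and `y, z ≤ x` have on average
the size that equidistribution predicts: fractions whose denominators have a common factor `g`
and are at most `g 2 ^ (k + 1)` are spaced by `1 / (g 4 ^ (k + 1))`. -/
lemma sum_paramTerm_dyadic_le {g y z k : ℕ} {h L : ℝ} (hh : 0 < h)
    (X : Finset ℕ) (hX : ∀ x ∈ X, IsAdmissible g x y z ∧ y ≤ x ∧ z ≤ x)
    (hk : ∀ x ∈ X, Nat.log 2 x = k) (hφ : ∀ x ∈ X, (x : ℝ) / Nat.totient x ≤ L) :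
    ∑ x ∈ X, paramTerm h g x y z ≤
      576 * L ^ 2 / h ^ 2 * (totientWeight g * totientWeight y * totientWeight z) := by
  have wg := totientWeight_nonneg g
  have wy := totientWeight_nonneg y
  have wz := totientWeight_nonneg z
  rcases X.eq_empty_or_nonempty with rfl | ⟨x₀, hx₀⟩
  · rw [Finset.sum_empty]; positivity
  obtain ⟨H₀, -, -⟩ := hX x₀ hx₀
  obtain ⟨pg, -, py, pz⟩ := H₀.pos
  have fg : (0 : ℝ) < Nat.totient g := by exact_mod_cast Nat.totient_pos.2 pg
  have fy : (0 : ℝ) < Nat.totient y := by exact_mod_cast Nat.totient_pos.2 py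
  have fz : (0 : ℝ) < Nat.totient z := by exact_mod_cast Nat.totient_pos.2 pz
  have lo : ∀ x ∈ X, 2 ^ k ≤ x := fun x hx => by
    rw [← hk x hx]; exact Nat.pow_log_le_self 2 (hX x hx).1.pos.2.1.ne'
  have up : ∀ x ∈ X, x ≤ 2 ^ (k + 1) := fun x hx => by
    rw [← hk x hx]; exact (Nat.lt_pow_succ_log_self (by norm_num) x).le
  have b := sum_tripleSum_le (g := g) (y := y) (z := z)
    (Δ := (g * (2 ^ (k + 1) * 2 ^ (k + 1)) : ℕ)) hh H₀.coprime_yz X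
    H₀.2.1 (fun x hx => (hX x hx).1.2.2) (fun x hx x' hx' => by
      have h1 : Nat.lcm x x' ≤ x * x' :=
        Nat.le_of_dvd (Nat.mul_pos (hX x hx).1.pos.2.1 (hX x' hx').1.pos.2.1)
          (Nat.lcm_dvd_mul x x')
      have h2 := Nat.mul_le_mul (up x hx) (up x' hx')
      exact_mod_cast Nat.mul_le_mul_left g (h1.trans h2)) (by positivity)
    (Or.inr fun x hx => by
      obtain ⟨-, hy, hz⟩ := hX x hx
      have h1 := Nat.mul_le_mul (up x hx) (hz.trans (up x hx))
      have h2 := Nat.mul_le_mul (up x hx) (hy.trans (up x hx))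
      rw [mul_assoc g x z, mul_assoc g x y]
      exact ⟨by exact_mod_cast Nat.mul_le_mul_left g h1,
        by exact_mod_cast Nat.mul_le_mul_left g h2⟩)
  set P : ℝ := (2 : ℝ) ^ k with hP
  have hP0 : 0 < P := by positivity
  have step : ∀ x ∈ X, paramTerm h g x y z ≤
      L ^ 2 / (P ^ 2 * ((Nat.totient g : ℝ) ^ 3 * (Nat.totient y : ℝ) ^ 2 *
        (Nat.totient z : ℝ) ^ 2)) * tripleSum h (g * y * z) (g * x * z) (g * x * y) := by
    intro x hx
    have fx : (0 : ℝ) < Nat.totient x := by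
      exact_mod_cast Nat.totient_pos.2 (hX x hx).1.pos.2.1
    have h1 : P ≤ x := by rw [hP]; exact_mod_cast lo x hx
    have h2 : P ≤ L * Nat.totient x := by
      have := hφ x hx
      rw [div_le_iff₀ fx] at this
      linarith
    have h3 : P ^ 2 ≤ L ^ 2 * (Nat.totient x : ℝ) ^ 2 := by
      rw [← mul_pow]; gcongr
    have h4 := tripleSum_nonneg hh.le (g * y * z) (g * x * z) (g * x * y)
    rw [paramTerm_eq (hX x hx).1, div_mul_eq_mul_div,
      div_le_div_iff₀ (by positivity) (by positivity)]
    set T := tripleSum h (g * y * z) (g * x * z) (g * x * y)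
    calc T * (P ^ 2 * ((Nat.totient g : ℝ) ^ 3 * (Nat.totient y : ℝ) ^ 2 *
          (Nat.totient z : ℝ) ^ 2))
        ≤ T * ((L ^ 2 * (Nat.totient x : ℝ) ^ 2) * ((Nat.totient g : ℝ) ^ 3 *
          (Nat.totient y : ℝ) ^ 2 * (Nat.totient z : ℝ) ^ 2)) := by gcongr
      _ = _ := by ring
  refine (Finset.sum_le_sum step).trans ?_
  rw [← Finset.mul_sum]
  have wy' := div_totient_sq_le_totientWeight py
  have wz' := div_totient_sq_le_totientWeight pz
  calc _ ≤ L ^ 2 / (P ^ 2 * ((Nat.totient g : ℝ) ^ 3 * (Nat.totient y : ℝ) ^ 2 *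
        (Nat.totient z : ℝ) ^ 2)) *
        (144 * (g * y * z : ℕ) * (g * (2 ^ (k + 1) * 2 ^ (k + 1)) : ℕ) / h ^ 2) := by gcongr
    _ = 576 * L ^ 2 / h ^ 2 * (totientWeight g * (y / (Nat.totient y : ℝ) ^ 2) *
        (z / (Nat.totient z : ℝ) ^ 2)) := by
        unfold totientWeight
        push_cast
        rw [pow_succ (2 : ℝ) k, ← hP]
        field_simp
        ring
    _ ≤ _ := by gcongr

lemma sum_paramTerm_le {g y z N : ℕ} {h L : ℝ} (hh : 0 < h)
    (X : Finset ℕ) (hX : ∀ x ∈ X, IsAdmissible g x y z ∧ y ≤ x ∧ z ≤ x)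
    (hN : ∀ x ∈ X, x ≤ N) (hφ : ∀ x ∈ X, (x : ℝ) / Nat.totient x ≤ L) :
    ∑ x ∈ X, paramTerm h g x y z ≤ (Nat.log 2 N + 1 : ℕ) *
      (576 * L ^ 2 / h ^ 2 * (totientWeight g * totientWeight y * totientWeight z)) := by
  have maps : ∀ x ∈ X, Nat.log 2 x ∈ Finset.range (Nat.log 2 N + 1) := fun x hx =>
    Finset.mem_range.2 (Nat.lt_succ_of_le (Nat.log_mono_right (hN x hx)))
  rw [← Finset.sum_fiberwise_of_maps_to maps]
  calc _ ≤ ∑ k ∈ Finset.range (Nat.log 2 N + 1),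
        576 * L ^ 2 / h ^ 2 * (totientWeight g * totientWeight y * totientWeight z) := by
        refine Finset.sum_le_sum fun k _ => ?_
        exact sum_paramTerm_dyadic_le hh _ (fun x hx => hX x (Finset.mem_filter.1 hx).1)
          (fun x hx => (Finset.mem_filter.1 hx).2) fun x hx => hφ x (Finset.mem_filter.1 hx).1
    _ = _ := by rw [Finset.sum_const, Finset.card_range, nsmul_eq_mul]

/-! ### Reduction of the singular series to the terms with parameters -/

lemma sum_numerators_eq (r : Fin 3 → ℕ) (f : ℕ × ℕ × ℕ → ℝ) :
    ∑ a ∈ numerators r, f (a 0, a 1, a 2) = ∑ t ∈ fracTriples (r 0) (r 1) (r 2), f t := by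
  refine Finset.sum_nbij' (fun a => (a 0, a 1, a 2)) (fun t => ![t.1, t.2.1, t.2.2])
    ?_ ?_ ?_ (fun _ _ => rfl) (fun _ _ => rfl)
  · intro a ha
    simp only [numerators, Finset.mem_filter, Fintype.mem_piFinset, Fin.sum_univ_three] at ha
    obtain ⟨h1, n, hn⟩ := ha
    have hn' := congrArg (Rat.cast (K := ℝ)) hn
    push_cast at hn'
    refine mem_fracTriples.2 ⟨⟨?_, ?_, ?_⟩, n, hn'⟩
    all_goals simp only [reducedNumerators, Finset.mem_filter]; exact h1 _
  · intro t ht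
    obtain ⟨⟨m1, m2, m3⟩, n, hn⟩ := mem_fracTriples.1 ht
    simp only [numerators, Finset.mem_filter, Fintype.mem_piFinset, Fin.sum_univ_three]
    refine ⟨fun i => ?_, n, ?_⟩
    · simp only [reducedNumerators, Finset.mem_filter] at m1 m2 m3
      fin_cases i
      exacts [m1, m2, m3]
    · have : (((t.1 : ℚ) / r 0 + (t.2.1 : ℚ) / r 1 + (t.2.2 : ℚ) / r 2 : ℚ) : ℝ) =
          ((n : ℚ) : ℝ) := by
        push_cast
        exact hn
      exact Rat.cast_injective this
  · intro a _
    ext i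
    fin_cases i <;> rfl

/-- Summing over the shifts `dᵢ` first turns the singular series sum into a sum of products of
geometric sums. -/
lemma singularSeriesSum_eq (k q h : ℕ) :
    singularSeriesSum k q h =
      ∑ r ∈ Fintype.piFinset (fun _ : Fin k => q.divisors.filter fun m => 1 < m),
        (∏ i, (ArithmeticFunction.moebius (r i) : ℂ) / (Nat.totient (r i) : ℂ)) *
          ∑ a ∈ numerators r, ∏ i, ∑ d ∈ Finset.Icc 1 h, addExp ((a i : ℝ) / r i * d) := by
  unfold singularSeriesSum
  rw [Finset.sum_comm]
  refine Finset.sum_congr rfl fun r _ => ?_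
  rw [← Finset.mul_sum, Finset.sum_comm]
  congr 1
  refine Finset.sum_congr rfl fun a _ => ?_
  rw [Finset.prod_univ_sum]
  refine Finset.sum_congr rfl fun d _ => ?_
  rw [addExp_sum]
  exact Finset.prod_congr rfl fun i _ => by rw [div_mul_eq_mul_div]

lemma norm_singularSeriesSum_le (q h : ℕ) :
    ‖singularSeriesSum 3 q h‖ ≤ 8 * (h : ℝ) ^ 3 *
      ∑ r ∈ Fintype.piFinset (fun _ : Fin 3 => q.divisors.filter fun m => 1 < m),
        tripleSum h (r 0) (r 1) (r 2) /
          (Nat.totient (r 0) * Nat.totient (r 1) * Nat.totient (r 2)) := by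
  rw [singularSeriesSum_eq, Finset.mul_sum]
  refine (norm_sum_le _ _).trans (Finset.sum_le_sum fun r hr => ?_)
  have hr1 : ∀ i, 1 < r i := fun i => (Finset.mem_filter.1 (Fintype.mem_piFinset.1 hr i)).2
  have hw : ‖∏ i, (ArithmeticFunction.moebius (r i) : ℂ) / (Nat.totient (r i) : ℂ)‖ ≤
      1 / (Nat.totient (r 0) * Nat.totient (r 1) * Nat.totient (r 2)) := by
    have hμ : ∀ i, ‖(ArithmeticFunction.moebius (r i) : ℂ) / (Nat.totient (r i) : ℂ)‖ ≤
        1 / (Nat.totient (r i) : ℝ) := fun i => by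
      have := ArithmeticFunction.abs_moebius_le_one (n := r i)
      rw [norm_div, Complex.norm_intCast, Complex.norm_natCast]
      gcongr
      exact_mod_cast this
    rw [norm_prod]
    refine (Finset.prod_le_prod (fun i _ => norm_nonneg _) fun i _ => hμ i).trans (le_of_eq ?_)
    rw [Fin.prod_univ_three]
    ring
  have hs : ‖∑ a ∈ numerators r, ∏ i, ∑ d ∈ Finset.Icc 1 h, addExp ((a i : ℝ) / r i * d)‖ ≤
      8 * (h : ℝ) ^ 3 * tripleSum h (r 0) (r 1) (r 2) := by
    refine (norm_sum_le _ _).trans ?_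
    unfold tripleSum
    rw [← sum_numerators_eq r, Finset.mul_sum]
    refine Finset.sum_le_sum fun a ha => ?_
    have hmem : ∀ i, a i ∈ reducedNumerators (r i) := by
      simp only [numerators, Finset.mem_filter, Fintype.mem_piFinset] at ha
      intro i
      simpa [reducedNumerators] using ha.1 i
    rw [norm_prod]
    refine (Finset.prod_le_prod (fun i _ => norm_nonneg _) fun i _ =>
      norm_sum_addExp_le (div_pos_of_mem_reducedNumerators (hr1 i) (hmem i))
        (div_lt_one_of_mem_reducedNumerators (hr1 i) (hmem i)) h).trans (le_of_eq ?_)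
    rw [Fin.prod_univ_three, div_mul_div_comm, div_mul_div_comm, mul_one_div]
    congr 1
    ring
  rw [norm_mul]
  refine (mul_le_mul hw hs (norm_nonneg _) (by positivity)).trans (le_of_eq ?_)
  ring

open Classical in
/-- The denominators that occur are parametrized by admissible `g, x, y, z` dividing `q`. -/
lemma sum_tripleSum_le_sum_paramTerm {q : ℕ} (hq : Squarefree q) {h : ℝ} (hh : 0 ≤ h) :
    ∑ r ∈ Fintype.piFinset (fun _ : Fin 3 => q.divisors.filter fun m => 1 < m),
        tripleSum h (r 0) (r 1) (r 2) /
          (Nat.totient (r 0) * Nat.totient (r 1) * Nat.totient (r 2)) ≤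
      ∑ g ∈ q.divisors, ∑ x ∈ q.divisors, ∑ y ∈ q.divisors, ∑ z ∈ q.divisors,
        if IsAdmissible g x y z then paramTerm h g x y z else 0 := by
  set D := q.divisors with hD
  set F : (Fin 3 → ℕ) → ℝ := fun r => tripleSum h (r 0) (r 1) (r 2) /
          (Nat.totient (r 0) * Nat.totient (r 1) * Nat.totient (r 2)) with hF
  have hF0 : ∀ r, 0 ≤ F r := fun r => by
    have := tripleSum_nonneg hh (r 0) (r 1) (r 2)
    simp only [hF]
    positivity
  set Q : Finset (ℕ × ℕ × ℕ × ℕ) := (D ×ˢ D ×ˢ D ×ˢ D).filter fun v =>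
    IsAdmissible v.1 v.2.1 v.2.2.1 v.2.2.2 with hQ
  set Φ : ℕ × ℕ × ℕ × ℕ → Fin 3 → ℕ := fun v =>
    ![v.1 * v.2.2.1 * v.2.2.2, v.1 * v.2.1 * v.2.2.2, v.1 * v.2.1 * v.2.2.1] with hΦ
  set R := Fintype.piFinset (fun _ : Fin 3 => D.filter fun m => 1 < m) with hR
  have sub : R.filter (fun r => (fracTriples (r 0) (r 1) (r 2)).Nonempty) ⊆ Q.image Φ := by
    intro r hr
    obtain ⟨h1, t, ht⟩ := Finset.mem_filter.1 hr
    have hd : ∀ i, r i ∣ q ∧ 1 < r i := fun i => by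
      have := Finset.mem_filter.1 (Fintype.mem_piFinset.1 h1 i)
      exact ⟨Nat.dvd_of_mem_divisors this.1, this.2⟩
    obtain ⟨g, x, y, z, e0, e1, e2⟩ := exists_param_of_mem_fracTriples ht
    have d0 := hd 0
    have d1 := hd 1
    have d2 := hd 2
    rw [e0] at d0
    rw [e1] at d1
    rw [e2] at d2
    have md : ∀ {a b : ℕ}, b ∣ q → a ∣ b → a ∈ D := fun hb ha =>
      Nat.mem_divisors.2 ⟨ha.trans hb, hq.ne_zero⟩
    refine Finset.mem_image.2 ⟨(g, x, y, z), Finset.mem_filter.2 ⟨?_,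
      ⟨hq.squarefree_of_dvd d0.1, hq.squarefree_of_dvd d1.1, hq.squarefree_of_dvd d2.1⟩,
      d0.2, d1.2, d2.2⟩, ?_⟩
    · simp only [Finset.mem_product]
      exact ⟨md d0.1 ⟨y * z, by ring⟩, md d1.1 ⟨g * z, by ring⟩, md d0.1 ⟨g * z, by ring⟩,
        md d0.1 ⟨g * y, by ring⟩⟩
    · ext i
      fin_cases i
      exacts [e0.symm, e1.symm, e2.symm]
  calc ∑ r ∈ R, F r
      = ∑ r ∈ R.filter (fun r => (fracTriples (r 0) (r 1) (r 2)).Nonempty), F r := by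
        refine (Finset.sum_filter_of_ne fun r _ hr => ?_).symm
        by_contra hne
        rw [Finset.not_nonempty_iff_eq_empty] at hne
        exact hr (by simp [hF, tripleSum, hne])
    _ ≤ ∑ r ∈ Q.image Φ, F r := Finset.sum_le_sum_of_subset_of_nonneg sub fun r _ _ => hF0 r
    _ ≤ ∑ v ∈ Q, F (Φ v) := Finset.sum_image_le_of_nonneg fun r _ => hF0 r
    _ = _ := by
        rw [hQ, Finset.sum_filter, Finset.sum_product]
        refine Finset.sum_congr rfl fun g _ => ?_
        rw [Finset.sum_product]
        refine Finset.sum_congr rfl fun x _ => ?_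
        rw [Finset.sum_product]
        rfl

open Classical in
/-- The term with parameters `g, x, y, z`, kept only if `x` is the largest of `x, y, z` and is at
most `N`. -/
noncomputable def dominantTerm (N g x y z : ℕ) : ℝ :=
  if IsAdmissible g x y z ∧ y ≤ x ∧ z ≤ x ∧ x ≤ N then paramTerm N g x y z else 0

lemma dominantTerm_nonneg (N g x y z : ℕ) : 0 ≤ dominantTerm N g x y z := by
  unfold dominantTerm
  split_ifs
  · exact paramTerm_nonneg (Nat.cast_nonneg _) _ _ _ _
  · exact le_rfl

/-- Either the fractions with one of the denominators `g x`, `g y`, `g z` are dense enough for a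
bound term by term, or `x, y, z ≤ N` and the term is kept for averaging over the largest. -/
lemma paramTerm_le {N g x y z : ℕ} (hN : 0 < N) (H : IsAdmissible g x y z) :
    paramTerm N g x y z ≤ 144 / (N : ℝ) ^ 2 *
      (totientWeight g * totientWeight x * totientWeight y * totientWeight z) +
      (dominantTerm N g x y z + dominantTerm N g y x z + dominantTerm N g z y x) := by
  have hN' : (0 : ℝ) < N := by exact_mod_cast hN
  have d1 := dominantTerm_nonneg N g x y z
  have d2 := dominantTerm_nonneg N g y x z
  have d3 := dominantTerm_nonneg N g z y x
  have wg := totientWeight_nonneg g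
  have wx := totientWeight_nonneg x
  have wy := totientWeight_nonneg y
  have wz := totientWeight_nonneg z
  have w : 0 ≤ 144 / (N : ℝ) ^ 2 *
      (totientWeight g * totientWeight x * totientWeight y * totientWeight z) := by positivity
  by_cases hx : N ≤ g * x
  · have := paramTerm_le_of_le H hN' (by exact_mod_cast hx)
    linarith
  by_cases hy : N ≤ g * y
  · have := paramTerm_le_of_le H.swap_xy hN' (by exact_mod_cast hy)
    rw [← paramTerm_swap_xy] at this
    linarith
  by_cases hz : N ≤ g * z
  · have := paramTerm_le_of_le H.swap_xz hN' (by exact_mod_cast hz)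
    rw [← paramTerm_swap_xz] at this
    linarith
  have pg := H.pos.1
  have hxN : x ≤ N := by have := Nat.le_mul_of_pos_left x pg; omega
  have hyN : y ≤ N := by have := Nat.le_mul_of_pos_left y pg; omega
  have hzN : z ≤ N := by have := Nat.le_mul_of_pos_left z pg; omega
  by_cases c1 : y ≤ x ∧ z ≤ x
  · have : dominantTerm N g x y z = paramTerm N g x y z := if_pos ⟨H, c1.1, c1.2, hxN⟩
    linarith
  by_cases c2 : x ≤ y ∧ z ≤ y
  · have : dominantTerm N g y x z = paramTerm N g x y z := by
      rw [paramTerm_swap_xy]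
      exact if_pos ⟨H.swap_xy, c2.1, c2.2, hyN⟩
    linarith
  · have : dominantTerm N g z y x = paramTerm N g x y z := by
      rw [paramTerm_swap_xz]
      exact if_pos ⟨H.swap_xz, by omega, by omega, hzN⟩
    linarith

lemma sum_dominantTerm_le {N : ℕ} (hN : 0 < N) (D : Finset ℕ) {L : ℝ}
    (hL : ∀ x, x ≤ N → Squarefree x → (x : ℝ) / Nat.totient x ≤ L) :
    ∑ g ∈ D, ∑ y ∈ D, ∑ z ∈ D, ∑ x ∈ D, dominantTerm N g x y z ≤
      (Nat.log 2 N + 1 : ℕ) * (576 * L ^ 2 / (N : ℝ) ^ 2 * (∑ d ∈ D, totientWeight d) ^ 3) := by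
  classical
  calc _ ≤ ∑ g ∈ D, ∑ y ∈ D, ∑ z ∈ D, (Nat.log 2 N + 1 : ℕ) * (576 * L ^ 2 / (N : ℝ) ^ 2 *
        (totientWeight g * totientWeight y * totientWeight z)) := by
        refine Finset.sum_le_sum fun g _ => Finset.sum_le_sum fun y _ =>
          Finset.sum_le_sum fun z _ => ?_
        unfold dominantTerm
        rw [← Finset.sum_filter]
        refine sum_paramTerm_le (by exact_mod_cast hN) _ (fun x hx => ?_) (fun x hx => ?_)
          fun x hx => ?_
        all_goals obtain ⟨-, H, hy, hz, hxN⟩ := Finset.mem_filter.1 hx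
        · exact ⟨H, hy, hz⟩
        · exact hxN
        · exact hL x hxN H.squarefree_x
    _ = _ := by
        simp_rw [← Finset.mul_sum, ← Finset.sum_mul]
        simp_rw [← Finset.mul_sum, ← Finset.sum_mul]
        ring

/-- The terms bounded one by one give the fourth power of the sum of the weights; the others give
the third power, times the number of dyadic blocks. -/
lemma sum_paramTerm_admissible_le {N : ℕ} (hN : 0 < N) (D : Finset ℕ) {L : ℝ}
    (hL : ∀ x, x ≤ N → Squarefree x → (x : ℝ) / Nat.totient x ≤ L)
    [∀ g x y z, Decidable (IsAdmissible g x y z)] :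
    (∑ g ∈ D, ∑ x ∈ D, ∑ y ∈ D, ∑ z ∈ D,
        if IsAdmissible g x y z then paramTerm N g x y z else 0) ≤
      144 / (N : ℝ) ^ 2 * (∑ d ∈ D, totientWeight d) ^ 4 + 3 * ((Nat.log 2 N + 1 : ℕ) *
        (576 * L ^ 2 / (N : ℝ) ^ 2 * (∑ d ∈ D, totientWeight d) ^ 3)) := by
  have hM := sum_dominantTerm_le hN D hL
  set M := ∑ g ∈ D, ∑ y ∈ D, ∑ z ∈ D, ∑ x ∈ D, dominantTerm N g x y z with hMdef
  have m1 : ∑ g ∈ D, ∑ x ∈ D, ∑ y ∈ D, ∑ z ∈ D, dominantTerm N g x y z = M := by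
    refine Finset.sum_congr rfl fun g _ => ?_
    rw [Finset.sum_comm]
    exact Finset.sum_congr rfl fun y _ => Finset.sum_comm
  have m2 : ∑ g ∈ D, ∑ x ∈ D, ∑ y ∈ D, ∑ z ∈ D, dominantTerm N g y x z = M :=
    Finset.sum_congr rfl fun g _ => Finset.sum_congr rfl fun x _ => Finset.sum_comm
  have m3 : ∑ g ∈ D, ∑ x ∈ D, ∑ y ∈ D, ∑ z ∈ D, dominantTerm N g z y x = M :=
    Finset.sum_congr rfl fun g _ => Finset.sum_comm
  have w : ∑ g ∈ D, ∑ x ∈ D, ∑ y ∈ D, ∑ z ∈ D, 144 / (N : ℝ) ^ 2 *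
      (totientWeight g * totientWeight x * totientWeight y * totientWeight z) =
      144 / (N : ℝ) ^ 2 * (∑ d ∈ D, totientWeight d) ^ 4 := by
    simp_rw [← Finset.mul_sum, ← Finset.sum_mul]
    simp_rw [← Finset.mul_sum, ← Finset.sum_mul]
    simp_rw [← Finset.mul_sum, ← Finset.sum_mul]
    ring
  calc _ ≤ ∑ g ∈ D, ∑ x ∈ D, ∑ y ∈ D, ∑ z ∈ D, (144 / (N : ℝ) ^ 2 *
        (totientWeight g * totientWeight x * totientWeight y * totientWeight z) +
        (dominantTerm N g x y z + dominantTerm N g y x z + dominantTerm N g z y x)) := by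
        refine Finset.sum_le_sum fun g _ => Finset.sum_le_sum fun x _ =>
          Finset.sum_le_sum fun y _ => Finset.sum_le_sum fun z _ => ?_
        split_ifs with H
        · exact paramTerm_le hN H
        · have := dominantTerm_nonneg N g x y z
          have := dominantTerm_nonneg N g y x z
          have := dominantTerm_nonneg N g z y x
          have := totientWeight_nonneg g
          have := totientWeight_nonneg x
          have := totientWeight_nonneg y
          have := totientWeight_nonneg z
          positivity
    _ = 144 / (N : ℝ) ^ 2 * (∑ d ∈ D, totientWeight d) ^ 4 + (M + M + M) := by
        simp_rw [Finset.sum_add_distrib]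
        rw [w, m1, m2, m3]
    _ ≤ _ := by linarith

/-- `log log h` stays away from `0`: it is negative at `h = 2` and at least `log log 3 > 0`
from `h = 3` on. -/
lemma exists_one_le_mul_abs_log_log :
    ∃ K : ℝ, 0 < K ∧ ∀ h : ℕ, 2 ≤ h → 1 ≤ K * |Real.log (Real.log h)| := by
  have l3 : 1 < Real.log 3 := by
    rw [Real.lt_log_iff_exp_lt (by norm_num)]
    exact Real.exp_one_lt_three
  have l2 : Real.log (Real.log 2) < 0 :=
    Real.log_neg (Real.log_pos (by norm_num)) (by have := Real.log_two_lt_d9; linarith)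
  have ll3 : 0 < Real.log (Real.log 3) := Real.log_pos l3
  have a2 : 0 < |Real.log (Real.log 2)| := abs_pos.2 l2.ne
  refine ⟨1 / |Real.log (Real.log 2)| + 1 / Real.log (Real.log 3), by positivity, fun h hh => ?_⟩
  rw [add_mul]
  rcases hh.eq_or_lt with rfl | h3
  · have : 1 / |Real.log (Real.log 2)| * |Real.log (Real.log (2 : ℕ))| = 1 := by
      push_cast; field_simp
    rw [this]
    have : 0 ≤ 1 / Real.log (Real.log 3) * |Real.log (Real.log (2 : ℕ))| := by positivity
    linarith
  · have h3' : (3 : ℝ) ≤ h := by exact_mod_cast h3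
    have h4 : Real.log 3 ≤ Real.log h := Real.log_le_log (by norm_num) h3'
    have h5 : Real.log (Real.log 3) ≤ |Real.log (Real.log h)| :=
      (Real.log_le_log (by linarith) h4).trans (le_abs_self _)
    have h6 : 1 ≤ 1 / Real.log (Real.log 3) * |Real.log (Real.log h)| := by
      rw [one_div_mul_eq_div, le_div_iff₀ ll3]
      linarith
    have : 0 ≤ 1 / |Real.log (Real.log 2)| * |Real.log (Real.log h)| := by positivity
    linarith

/-- `primorial (h ^ 4)` is the product of the primes `p ≤ h ^ 4`. -/
theorem theorem2p1 :
    ∃ C : ℝ, 0 < C ∧ ∀ h : ℕ, 2 ≤ h →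
      ‖singularSeriesSum 3 (primorial (h ^ 4)) h‖ ≤
        C * ((h : ℝ) * Real.log (h : ℝ) ^ 4 * Real.log (Real.log (h : ℝ)) ^ 2) := by
  classical
  obtain ⟨A, hA, HA⟩ := exists_sum_sq_div_totient_cube_le
  obtain ⟨B, hB, HB⟩ := exists_div_totient_le
  obtain ⟨K, hK, HK⟩ := exists_one_le_mul_abs_log_log
  refine ⟨8 * (144 * (4 * A) ^ 4 * K ^ 2 + 6912 * (B * (K + 1)) ^ 2 * (4 * A) ^ 3),
    by positivity, fun h hh => ?_⟩
  have hpos : 0 < h := by omega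
  have hR : (0 : ℝ) < h := by exact_mod_cast hpos
  have one := HK h hh
  set lam := |Real.log (Real.log h)| with hlam
  have lam0 : 0 ≤ lam := abs_nonneg _
  have lamsq : Real.log (Real.log h) ^ 2 = lam ^ 2 := (sq_abs _).symm
  have l0 : 0 < Real.log h := Real.log_pos (by exact_mod_cast hh)
  have dyadic := natLog_add_one_le hh
  set l := Real.log h with hl
  set S := ∑ d ∈ (primorial (h ^ 4)).divisors, totientWeight d with hS
  have hS0 : 0 ≤ S := Finset.sum_nonneg fun d _ => totientWeight_nonneg d
  have hS1 : S ≤ 4 * A * l := by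
    have := HA (h ^ 4) (hh.trans (Nat.le_self_pow (by norm_num) h))
    push_cast at this
    rw [Real.log_pow] at this
    refine this.trans (le_of_eq ?_)
    push_cast
    ring
  have hL : ∀ x, x ≤ h → Squarefree x → (x : ℝ) / Nat.totient x ≤ B * (K + 1) * lam := by
    intro x hx hsq
    refine (HB h x hh hx hsq).trans ?_
    rw [mul_assoc]
    gcongr
    linarith
  have one2 : 1 ≤ K ^ 2 * lam ^ 2 := by
    rw [← mul_pow]
    exact one_le_pow₀ one
  have main := (norm_singularSeriesSum_le (primorial (h ^ 4)) h).trans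
    (mul_le_mul_of_nonneg_left ((sum_tripleSum_le_sum_paramTerm (squarefree_primorial _)
      hR.le).trans (sum_paramTerm_admissible_le hpos _ hL)) (by positivity))
  refine main.trans ?_
  rw [← hS, lamsq]
  have b1 : S ^ 4 ≤ (4 * A * l) ^ 4 * (K ^ 2 * lam ^ 2) := by
    calc S ^ 4 ≤ (4 * A * l) ^ 4 * 1 := by rw [mul_one]; gcongr
      _ ≤ _ := by gcongr
  calc _ ≤ 8 * (h : ℝ) ^ 3 * (144 / (h : ℝ) ^ 2 * ((4 * A * l) ^ 4 * (K ^ 2 * lam ^ 2)) +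
        3 * (4 * l * (576 * (B * (K + 1) * lam) ^ 2 / (h : ℝ) ^ 2 * (4 * A * l) ^ 3))) := by
        gcongr
    _ = _ := by
        field_simp
        ring
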